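/- Let $\mathcal H_{\mathrm{in}},\mathcal H_{\mathrm{out}}$ be finite-dimensional complex Hilbert spaces, let $\Phi$ be a quantum channel (completely positive trace-preserving map) from operators on $\mathcal H_{\mathrm{in}}$ to operators on $\mathcal H_{\mathrm{out}}$, and let $\Delta$ be a tangent vector at $\Phi$, i.e. a Hermiticity-preserving linear map between the same spaces with $\operatorname{tr}\Delta(X)=0$ for all $X$. Put $\Delta^{(n)}:=\Delta\otimes\Phi^{\otimes n-1}+\Phi\otimes\Delta\otimes\Phi^{\otimes n-2}+\cdots+\Phi^{\otimes n-1}\otimes\Delta$. All quantities below take values in $[0,\infty]$. For a probability distribution $p$ and a real function $\delta$ on a finite set let $J_p(\delta)=\sum_x \delta(x)^2/p(x)$ (with $0/0=0$, $a/0=\infty$ for $a>0$); for a signed measure $\delta=s\,q$ with density $s$ with respect to a probability measure $q$ on $\mathbb R$ let $J_q(\delta)=\int s^2\,dq$. For a density operator $\rho$ and an operator $\delta$ let $J^R_\rho(\delta)=\operatorname{Re}\operatorname{tr}(\rho L^\dagger L)$, where $L$ solves $\delta=L\rho$ (RLD Fisher information), and $J^R_\rho(\delta)=\infty$ if there is no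 solution. For a channel $\Psi$ and a tangent vector $D$ at $\Psi$ put $$G^{\min}_\Psi(D)=\sup_{\mathcal K,\rho,M}J_{M((\Psi\otimes\mathbf I_{\mathcal K})(\rho))}\bigl(M((D\otimes\mathbf I_{\mathcal K})(\rho))\bigr),\qquad G^{R}_\Psi(D)=\sup_{\mathcal K,\rho}J^R_{(\Psi\otimes\mathbf I_{\mathcal K})(\rho)}\bigl((D\otimes\mathbf I_{\mathcal K})(\rho)\bigr),$$ where $\mathcal K$ runs over all finite-dimensional ancilla spaces, $\rho$ over all density operators on (input space) $\otimes\,\mathcal K$, and $M=(M_x)$ over all finite-outcome POVMs on (output space) $\otimes\,\mathcal K$, with $M(\sigma)(x)=\operatorname{tr}M_x\sigma$. Define $$G^{p,\min}_\Phi(\Delta)=\lim_{n\to\infty}\tfrac1n G^{\min}_{\Phi^{\otimes n}}(\Delta^{(n)}),\qquad G^{p,R}_\Phi(\Delta)=\lim_{n\to\infty}\tfrac1n G^{R}_{\Phi^{\otimes n}}(\Delta^{(n)}).$$ A Gaussian shift is a pair $(q,\delta)$ with $q=\mathrm N(a,\sigma^2)$ and $\delta=c\,\frac{x-a}{\sigma^2}\,q$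 for some $a,c\in\mathbb R$, $\sigma^2>0$. Let $\tilde G^{p,\max}_\Phi(\Delta)$ be the infimum (with $\inf\emptyset=\infty$) of $\liminf_{n\to\infty}\frac1n J_{q^n}(\delta^n)$ over all asymptotic parallel tangent simulations of $(\Phi,\Delta)$ by Gaussian shifts, i.e. over all sequences of Gaussian shifts $(q^n,\delta^n)$ and of measurable families $\Lambda^n=(\Lambda^n_x)_{x\in\mathbb R}$ of channels from operators on $\mathcal H_{\mathrm{in}}^{\otimes n}$ to operators on $\mathcal H_{\mathrm{out}}^{\otimes n}$ such that, writing $\Lambda^n\circ(\mathbf I\otimes\mu)=\int\Lambda^n_x\,d\mu(x)$, $$\lim_{n\to\infty}\bigl\|\Phi^{\otimes n}-\Lambda^n\circ(\mathbf I\otimes q^n)\bigr\|_{\mathrm{cb}}=0,\qquad \lim_{n\to\infty}\tfrac1{\sqrt n}\bigl\|\Delta^{(n)}-\Lambda^n\circ(\mathbf I\otimes\delta^n)\bigr\|_{\mathrm{cb}}=0,$$ where $\|\Psi\|_{\mathrm{cb}}=\sup_k\|\Psi\otimes\mathbf I_{\mathbb C^k}\|$, with norms taken with respect to the trace norms. Then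 the limits defining $G^{p,\min}_\Phi(\Delta)$ and $G^{p,R}_\Phi(\Delta)$ exist in $[0,\infty]$, and $$G^{p,\min}_\Phi(\Delta)\le G^{p,R}_\Phi(\Delta)\le\tilde G^{p,\max}_\Phi(\Delta).$$ -/

import Mathlib

open Filter Topology MeasureTheory ProbabilityTheory
open scoped ENNReal NNReal ComplexOrder Matrix

noncomputable section

namespace QChannel

/-- Operators on the finite-dimensional Hilbert space `ℂ^d`, as matrices indexed by an orthonormal
basis.  The `n`-fold tensor power of `ℂ^d` is `ℂ^(Fin n → d)`, and `ℂ^d ⊗ ℂ^κ` is `ℂ^(d × κ)`. -/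
abbrev Op (d : Type*) := Matrix d d ℂ

/-- Linear maps from operators on `ℂ^d` to operators on `ℂ^e`. -/
abbrev SuperOp (d e : Type*) := Op d →ₗ[ℂ] Op e

section basic

variable {d e : Type*}

/-- The linear map `X ↦ Y`, `Y i j = ∑ k l, c i j k l * X k l`, with prescribed coefficients
with respect to the matrix units. -/
def SuperOp.ofCoeff [Fintype d] (c : e → e → d → d → ℂ) : SuperOp d e where
  toFun X := Matrix.of fun i j => ∑ k, ∑ l, c i j k l * X k l
  map_add' X Y := by
    ext i j
    simp [mul_add, Finset.sum_add_distrib]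
  map_smul' a X := by
    ext i j
    simp [Finset.mul_sum, mul_left_comm]

/-- The coefficients of a linear map of operators: `coeff Φ i j k l = ⟨i| Φ(|k⟩⟨l|) |j⟩`. -/
def SuperOp.coeff [DecidableEq d] (Φ : SuperOp d e) (i j : e) (k l : d) : ℂ :=
  Φ (Matrix.single k l 1) i j

/-- The tensor product `Ψ 0 ⊗ ⋯ ⊗ Ψ (n - 1)`. -/
def SuperOp.tensor [Fintype d] [DecidableEq d] {n : ℕ} (Ψ : Fin n → SuperOp d e) :
    SuperOp (Fin n → d) (Fin n → e) :=
  SuperOp.ofCoeff fun i j k l => ∏ t, (Ψ t).coeff (i t) (j t) (k t) (l t)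

/-- The tensor power `Φ^{⊗ n}`. -/
def SuperOp.power [Fintype d] [DecidableEq d] (Φ : SuperOp d e) (n : ℕ) :
    SuperOp (Fin n → d) (Fin n → e) :=
  SuperOp.tensor fun _ : Fin n => Φ

/-- `Δ^{(n)} = Δ ⊗ Φ^{⊗ n-1} + Φ ⊗ Δ ⊗ Φ^{⊗ n-2} + ⋯ + Φ^{⊗ n-1} ⊗ Δ`. -/
def SuperOp.tangentPower [Fintype d] [DecidableEq d] (Φ Δ : SuperOp d e) (n : ℕ) :
    SuperOp (Fin n → d) (Fin n → e) :=
  ∑ t : Fin n, SuperOp.tensor (Function.update (fun _ => Φ) t Δ)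

/-- `Φ ⊗ I`, where `I` is the identity map on the operators on `ℂ^κ`. -/
def SuperOp.ampliate (Φ : SuperOp d e) (κ : Type*) : SuperOp (d × κ) (e × κ) where
  toFun X := Matrix.of fun i j => Φ (Matrix.of fun k l => X (k, i.2) (l, j.2)) i.1 j.1
  map_add' X Y := by
    ext i j
    exact congrFun (congrFun (Φ.map_add (Matrix.of fun k l => X (k, i.2) (l, j.2))
      (Matrix.of fun k l => Y (k, i.2) (l, j.2))) i.1) j.1
  map_smul' a X := by
    ext i j
    exact congrFun (congrFun (Φ.map_smul a (Matrix.of fun k l => X (k, i.2) (l, j.2))) i.1) j.1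

/-- Quantum channels: completely positive trace preserving maps. -/
structure IsChannel [Fintype d] [Fintype e] (Φ : SuperOp d e) : Prop where
  completelyPositive : ∀ (k : ℕ) (X : Op (d × Fin k)),
    X.PosSemidef → (Φ.ampliate (Fin k) X).PosSemidef
  tracePreserving : ∀ X : Op d, (Φ X).trace = X.trace

/-- Tangent vectors to the set of channels: Hermiticity preserving maps whose values have trace
zero (the direction space of the affine hull of the set of channels). -/
structure IsTangent [Fintype e] (Δ : SuperOp d e) : Prop where
  hermitian : ∀ X : Op d, X.IsHermitian → (Δ X).IsHermitian
  traceZero : ∀ X : Op d, (Δ X).trace = 0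

/-- Density operators. -/
structure IsState [Fintype d] (ρ : Op d) : Prop where
  posSemidef : ρ.PosSemidef
  trace_eq_one : ρ.trace = 1

/-- The trace norm `‖X‖₁`, the sum of the singular values of `X`. -/
def traceNorm [Fintype d] [DecidableEq d] (X : Op d) : ℝ :=
  ∑ i, Real.sqrt ((Matrix.isHermitian_conjTranspose_mul_self X).eigenvalues i)

/-- The completely bounded norm of a map between trace class operators: the supremum over `k` of
the norm of `Ψ ⊗ I_k` with respect to the trace norms. -/
def cbNorm [Fintype d] [DecidableEq d] [Fintype e] [DecidableEq e] (Ψ : SuperOp d e) : ℝ≥0∞ :=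
  ⨆ (k : ℕ) (X : Op (d × Fin k)) (_ : traceNorm X ≤ 1),
    ENNReal.ofReal (traceNorm (Ψ.ampliate (Fin k) X))

end basic

section Fisher

variable {d : Type*}

/-- Classical Fisher information `∑ x, δ(x)² / p(x)` of the local data `(p, δ)` on a finite set,
where `0 / 0 = 0` and `a / 0 = ∞` for `a > 0`. -/
def fisherFinite {α : Type*} [Fintype α] (p δ : α → ℝ) : ℝ≥0∞ :=
  ∑ x, ENNReal.ofReal (δ x ^ 2) / ENNReal.ofReal (p x)

/-- Classical Fisher information of the local data `(q, δ)`, where the signed measure `δ` has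
density `s = dδ/dq` with respect to `q`. -/
def fisherDensity (q : Measure ℝ) (s : ℝ → ℝ) : ℝ≥0∞ :=
  ∫⁻ x, ENNReal.ofReal (s x ^ 2) ∂q

/-- RLD Fisher information: `Re tr (ρ L† L)` for a solution `L` of `δ = L ρ` (the value does not
depend on the solution), and `∞` if there is no solution. -/
def fisherRLD [Fintype d] (ρ δ : Op d) : ℝ≥0∞ :=
  ⨅ (L : Op d) (_ : δ = L * ρ), ENNReal.ofReal (ρ * Lᴴ * L).trace.re

/-- Measurements (POVMs) with finitely many outcomes. -/
structure IsPOVM [Fintype d] [DecidableEq d] {m : ℕ} (M : Fin m → Op d) : Prop where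
  posSemidef : ∀ x, (M x).PosSemidef
  sum_eq_one : ∑ x, M x = 1

/-- The (signed) measure `x ↦ tr (M_x σ)` of the outcome of a measurement. -/
def outcome [Fintype d] {m : ℕ} (M : Fin m → Op d) (σ : Op d) (x : Fin m) : ℝ :=
  (M x * σ).trace.re

end Fisher

section metrics

variable {d e : Type*} [Fintype d] [DecidableEq d] [Fintype e] [DecidableEq e]

/-- `G^min_Φ(Δ)`: the supremum, over all ancillas `ℂ^k`, all input states of `ℂ^d ⊗ ℂ^k` and all
measurements of the output together with the ancilla, of the Fisher information of the measurement
outcome. -/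
def Gmin (Φ Δ : SuperOp d e) : ℝ≥0∞ :=
  ⨆ (k : ℕ) (ρ : Op (d × Fin k)) (_ : IsState ρ) (m : ℕ) (M : Fin m → Op (e × Fin k))
    (_ : IsPOVM M),
    fisherFinite (outcome M (Φ.ampliate (Fin k) ρ)) (outcome M (Δ.ampliate (Fin k) ρ))

/-- The supremum, over all ancillas `ℂ^k` and all input states of `ℂ^d ⊗ ℂ^k`, of the RLD Fisher
information of the output. -/
def GR (Φ Δ : SuperOp d e) : ℝ≥0∞ :=
  ⨆ (k : ℕ) (ρ : Op (d × Fin k)) (_ : IsState ρ),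
    fisherRLD (Φ.ampliate (Fin k) ρ) (Δ.ampliate (Fin k) ρ)

/-- `n⁻¹ G^min_{Φ^{⊗n}}(Δ^{(n)})`. -/
def rateMin (Φ Δ : SuperOp d e) (n : ℕ) : ℝ≥0∞ :=
  Gmin (Φ.power n) (Φ.tangentPower Δ n) / (n : ℝ≥0∞)

/-- `n⁻¹ sup_ρ J^R(Φ^{⊗n}(ρ), Δ^{(n)}(ρ))`. -/
def rateR (Φ Δ : SuperOp d e) (n : ℕ) : ℝ≥0∞ :=
  GR (Φ.power n) (Φ.tangentPower Δ n) / (n : ℝ≥0∞)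

/-- `G^{p,min}_Φ(Δ)`, the limit of `rateMin Φ Δ`; it is written as a limit superior, so that it
is defined before the limit is known to exist. -/
def GpMin (Φ Δ : SuperOp d e) : ℝ≥0∞ := limsup (rateMin Φ Δ) atTop

/-- `G^{p,R}_Φ(Δ)`, the limit of `rateR Φ Δ`; it is written as a limit superior, so that it is
defined before the limit is known to exist. -/
def GpR (Φ Δ : SuperOp d e) : ℝ≥0∞ := limsup (rateR Φ Δ) atTop

/-- A channel with input a quantum system and a real number, and output a quantum system:
a measurable family of channels indexed by the real number. -/
structure IsHybridChannel (Λ : ℝ → SuperOp d e) : Prop where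
  isChannel : ∀ x, IsChannel (Λ x)
  measurable : ∀ (X : Op d) (i j : e), Measurable fun x => Λ x X i j

/-- `Λ ∘ (I ⊗ μ)` for the signed measure `μ = s · q`, i.e. `X ↦ ∫ Λ_x(X) s(x) dq(x)`. -/
def feed (Λ : ℝ → SuperOp d e) (q : Measure ℝ) (s : ℝ → ℝ) : SuperOp d e :=
  SuperOp.ofCoeff fun i j k l => ∫ x, (s x : ℂ) * (Λ x).coeff i j k l ∂q

/-- `(q, δ)` with `δ = s · q` is a Gaussian shift: `q = N(a, v)` and `δ = c · δN(a, v)`, where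
`δN(a, v)` has density `(x - a) / v` with respect to `N(a, v)`. -/
def IsGaussianShift (q : Measure ℝ) (s : ℝ → ℝ) : Prop :=
  ∃ (a : ℝ) (v : ℝ≥0) (c : ℝ), v ≠ 0 ∧ q = gaussianReal a v ∧ s = fun x => c * ((x - a) / v)

/-- Asymptotic parallel classical tangent simulations of `(Φ, Δ)`; the signed measure `δ'^n` has
density `s n` with respect to `q n`. -/
structure IsAsymptoticSimulation (Φ Δ : SuperOp d e) (q : ℕ → Measure ℝ) (s : ℕ → ℝ → ℝ)
    (Λ : (n : ℕ) → ℝ → SuperOp (Fin n → d) (Fin n → e)) : Prop where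
  isHybridChannel : ∀ n, IsHybridChannel (Λ n)
  channel_approx :
    Tendsto (fun n => cbNorm (Φ.power n - feed (Λ n) (q n) (fun _ => 1))) atTop (𝓝 0)
  tangent_approx :
    Tendsto (fun n => cbNorm (Φ.tangentPower Δ n - feed (Λ n) (q n) (s n)) /
      ENNReal.ofReal (Real.sqrt n)) atTop (𝓝 0)

/-- `G̃^{p,max}_Φ(Δ)`: the infimum of the asymptotic rates `liminf n⁻¹ J_{q^n}(δ'^n)` of the
asymptotic parallel tangent simulations of `(Φ, Δ)` by Gaussian shifts (`∞` if there is none). -/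
def GpMaxTilde (Φ Δ : SuperOp d e) : ℝ≥0∞ :=
  ⨅ (q : ℕ → Measure ℝ) (s : ℕ → ℝ → ℝ)
    (Λ : (n : ℕ) → ℝ → SuperOp (Fin n → d) (Fin n → e))
    (_ : ∀ n, IsGaussianShift (q n) (s n)) (_ : IsAsymptoticSimulation Φ Δ q s Λ),
    liminf (fun n => fisherDensity (q n) (s n) / (n : ℝ≥0∞)) atTop

end metrics

end QChannel

end

/-!
The two limits are instances of Fekete's lemma, and their existence and the second
inequality rest on the variational formula
`J^R_σ(δ) = sup_T (2 Re tr (δ T†) - tr (T σ T†))` for the RLD Fisher information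
(`fisherRLD_eq_iSup`; the bracket is `rldTest σ δ T`), which covers the value `∞` as well.

*Existence of the limits.*  On a product input `Δ^{(m+n)}` obeys the Leibniz rule
`tangentPower_append`, and test operators `T`, `T'` for the two parts combine to `T ⊗ 1 + 1 ⊗ T'`.
If they are centred (`tr (T σ) = 0`, no restriction because `tr δ = 0`), the cross terms vanish;
hence `G^R` is superadditive in the number of copies. The same holds for the classical Fisher
information, which is the RLD Fisher information of diagonal operators, and so for `G^min`.

*First inequality.*  A measurement does not increase the RLD Fisher information
(`fisherFinite_outcome_le`), by the Cauchy-Schwarz inequality for each outcome.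

*Second inequality.*  By the variational formula, a simulation `(q, s, Λ)` satisfies
`rldTest σ' δ' T ≤ J_q(s q)` for every `T`, where `(σ', δ')` is the simulated pair of outputs
(`rldTest_feed_le`). Replacing `(σ', δ')` by the true outputs costs
`O(‖T‖) ‖Δ^{(n)} - ⋯‖_cb + ‖T‖² ‖Φ^{⊗n} - ⋯‖_cb`, which is `o(n)` provided `‖T‖ = O(√n)`. The sum
`∑ T_t` of copies of a single block operator `T = ∑ i, w_i (i H_i)`, with `H_i` Hermitian, has
norm of order `n`. It is replaced by `(√N / ε) ∑ i, w_i (A_i^{⊗N} - 1)`, where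
`A_i = 1 + i (ε / √N) H_i` and `N` is the number of blocks. Since `A_i A_i† = 1 + (ε² / N) H_i²`, the powers
`A_i^{⊗N}` stay bounded; for centred `H_i` the linear term of the test value is exactly `N` times
that of `T`, and the quadratic term is `N` times that of `T` up to an error `N O(ε²)`, by
`(1 + ε² m / N)^N - 1 ≈ ε² m` (`re_sum_one_add_pow_le`). Letting `n → ∞` and then `ε → 0`, the
rate of the simulation is at least the test value of `T` per copy (`rldTest_le_liminf`), and the
supremum over `T`, the inputs and the block length is `G^{p,R}`.
-/

open scoped Kronecker

namespace QChannel

/-! ### Linearity of ampliation -/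

section ampliate

variable {d e : Type*} (κ : Type*) (X : Op (d × κ))

theorem SuperOp.ampliate_add (Φ Ψ : SuperOp d e) :
    (Φ + Ψ).ampliate κ X = Φ.ampliate κ X + Ψ.ampliate κ X := rfl

theorem SuperOp.ampliate_sub (Φ Ψ : SuperOp d e) :
    (Φ - Ψ).ampliate κ X = Φ.ampliate κ X - Ψ.ampliate κ X := rfl

theorem SuperOp.ampliate_sum {ι : Type*} (s : Finset ι) (Φ : ι → SuperOp d e) :
    (∑ t ∈ s, Φ t).ampliate κ X = ∑ t ∈ s, (Φ t).ampliate κ X := by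
  ext i j
  simp [SuperOp.ampliate, Matrix.sum_apply]

end ampliate

/-! ### Choi matrices and tensor powers -/

section coefficients

variable {d e : Type*} [Fintype d] [DecidableEq d]

theorem SuperOp.apply_eq_sum_coeff (Φ : SuperOp d e) (X : Op d) (i j : e) :
    Φ X i j = ∑ k, ∑ l, Φ.coeff i j k l * X k l := by
  have h : X = ∑ k, ∑ l, X k l • Matrix.single k l (1 : ℂ) := by
    conv_lhs => rw [Matrix.matrix_eq_sum_single X]
    simp [Matrix.smul_single]
  conv_lhs => rw [h]
  simp only [map_sum, map_smul, Matrix.sum_apply, Matrix.smul_apply, smul_eq_mul, SuperOp.coeff]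
  exact Finset.sum_congr rfl fun k _ => Finset.sum_congr rfl fun l _ => mul_comm _ _

@[simp]
theorem SuperOp.coeff_ofCoeff (c : e → e → d → d → ℂ) (i j : e) (k l : d) :
    (SuperOp.ofCoeff c).coeff i j k l = c i j k l := by
  simp [SuperOp.coeff, SuperOp.ofCoeff, Matrix.single_apply, ite_and]

theorem SuperOp.coeff_tensor {n : ℕ} (Ψ : Fin n → SuperOp d e) (i j : Fin n → e)
    (k l : Fin n → d) :
    (SuperOp.tensor Ψ).coeff i j k l = ∏ t, (Ψ t).coeff (i t) (j t) (k t) (l t) :=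
  SuperOp.coeff_ofCoeff _ _ _ _ _

theorem SuperOp.ampliate_apply (Φ : SuperOp d e) {κ : Type*} (X : Op (d × κ)) (i j : e × κ) :
    Φ.ampliate κ X i j = ∑ k, ∑ l, Φ.coeff i.1 j.1 k l * X (k, i.2) (l, j.2) :=
  Φ.apply_eq_sum_coeff _ _ _

/-- The Choi matrix of a linear map of operators. -/
def SuperOp.choi (Φ : SuperOp d e) : Op (e × d) :=
  Matrix.of fun x y => Φ.coeff x.1 y.1 x.2 y.2

/-- The Choi matrix is the image of the unnormalised maximally entangled state. -/
theorem IsChannel.posSemidef_choi [Fintype e] {Φ : SuperOp d e} (hΦ : IsChannel Φ) :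
    Φ.choi.PosSemidef := by
  classical
  let f := Fintype.equivFin d
  let v : d × Fin (Fintype.card d) → ℂ := fun x => if f x.1 = x.2 then 1 else 0
  have h := hΦ.completelyPositive _ _ (Matrix.posSemidef_vecMulVec_self_star v)
  have h2 := h.submatrix fun x : e × d => (x.1, f x.2)
  convert h2 using 1
  ext x y
  simp [SuperOp.choi, SuperOp.ampliate_apply, Matrix.vecMulVec_apply, v, apply_ite]

theorem SuperOp.ampliate_posSemidef [Fintype e] {Φ : SuperOp d e} (hΦ : Φ.choi.PosSemidef)
    {κ : Type*} [Fintype κ] [DecidableEq κ] {X : Op (d × κ)} (hX : X.PosSemidef) :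
    (Φ.ampliate κ X).PosSemidef := by
  classical
  -- `Φ ⊗ I (X)` is a compression of `choi Φ ⊗ X`.
  let W : Matrix (e × κ) ((e × d) × (d × κ)) ℂ :=
    Matrix.of fun x y => if y.1.1 = x.1 ∧ y.2.2 = x.2 ∧ y.1.2 = y.2.1 then 1 else 0
  have h : Φ.ampliate κ X = W * (Φ.choi ⊗ₖ X) * Wᴴ := by
    ext x y
    rw [SuperOp.ampliate_apply]
    simp only [Matrix.mul_apply, Matrix.conjTranspose_apply, W, Matrix.of_apply,
      Matrix.kroneckerMap_apply, Fintype.sum_prod_type, SuperOp.choi]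
    simp [ite_and, apply_ite, Finset.sum_ite_eq]
    rw [Finset.sum_comm]
  rw [h]
  exact (hΦ.kronecker hX).mul_mul_conjTranspose_same W

theorem SuperOp.trace_ampliate [Fintype e] {Φ : SuperOp d e} {κ : Type*} [Fintype κ]
    (X : Op (d × κ)) :
    (Φ.ampliate κ X).trace = ∑ a, ∑ k, ∑ l, (∑ i, Φ.coeff i i k l) * X (k, a) (l, a) := by
  simp only [Matrix.trace, Matrix.diag_apply, Fintype.sum_prod_type, SuperOp.ampliate_apply,
    Finset.sum_mul]
  rw [Finset.sum_comm]
  refine Finset.sum_congr rfl fun a _ => ?_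
  rw [Finset.sum_comm]
  refine Finset.sum_congr rfl fun k _ => ?_
  rw [Finset.sum_comm]

open scoped MatrixOrder in
theorem exists_eq_conjTranspose_mul_self {m : Type*} [Fintype m] [DecidableEq m] {C : Op m}
    (hC : C.PosSemidef) : ∃ B : Op m, C = Bᴴ * B :=
  CStarAlgebra.nonneg_iff_eq_star_mul_self.1 hC.nonneg

/-- If `C = B† B` is the Choi matrix of `Φ`, the Choi matrix of `Φ^{⊗ n}` is the Gram matrix of
the product vectors made of the columns of `B`. -/
theorem SuperOp.posSemidef_choi_power [Fintype e] {Φ : SuperOp d e} (hΦ : Φ.choi.PosSemidef)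
    (n : ℕ) : (Φ.power n).choi.PosSemidef := by
  classical
  obtain ⟨B, hB⟩ := exists_eq_conjTranspose_mul_self hΦ
  let B' : Matrix (Fin n → e × d) ((Fin n → e) × (Fin n → d)) ℂ :=
    Matrix.of fun f x => ∏ t, B (f t) (x.1 t, x.2 t)
  have hc (i j : e) (k l : d) : Φ.coeff i j k l = ∑ r, star (B r (i, k)) * B r (j, l) := by
    have := congrFun (congrFun hB (i, k)) (j, l)
    simpa [Matrix.mul_apply, SuperOp.choi] using this
  have h : (Φ.power n).choi = B'ᴴ * B' := by
    ext x y
    simp only [SuperOp.choi, SuperOp.power, Matrix.of_apply, SuperOp.coeff_tensor, hc,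
      Matrix.mul_apply, Matrix.conjTranspose_apply, B', Finset.prod_univ_sum,
      Fintype.piFinset_univ, Finset.prod_mul_distrib, star_prod]
  rw [h]
  exact Matrix.posSemidef_conjTranspose_mul_self B'

theorem SuperOp.sum_coeff_tensor [Fintype e] {n : ℕ} (Ψ : Fin n → SuperOp d e)
    (k l : Fin n → d) :
    ∑ i, (SuperOp.tensor Ψ).coeff i i k l = ∏ t, ∑ i, (Ψ t).coeff i i (k t) (l t) := by
  classical
  simp only [SuperOp.coeff_tensor, Finset.prod_univ_sum, Fintype.piFinset_univ]

theorem IsChannel.sum_coeff [Fintype e] {Φ : SuperOp d e} (hΦ : IsChannel Φ) (k l : d) :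
    ∑ i, Φ.coeff i i k l = if k = l then 1 else 0 := by
  rw [show ∑ i, Φ.coeff i i k l = _ from hΦ.tracePreserving (Matrix.single k l 1)]
  split_ifs with h
  · simp [h]
  · simp [Matrix.trace_single_eq_of_ne _ _ _ h]

theorem IsChannel.sum_coeff_power [Fintype e] {Φ : SuperOp d e} (hΦ : IsChannel Φ) (n : ℕ)
    (k l : Fin n → d) :
    ∑ i, (Φ.power n).coeff i i k l = if k = l then 1 else 0 := by
  rw [SuperOp.power, SuperOp.sum_coeff_tensor]
  simp only [hΦ.sum_coeff, Finset.prod_ite_zero, Finset.prod_const_one, funext_iff,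
    Finset.mem_univ, true_imp_iff]

theorem IsTangent.sum_coeff_tangentPower [Fintype e] {Δ : SuperOp d e} (hΔ : IsTangent Δ)
    (Φ : SuperOp d e) (n : ℕ) (k l : Fin n → d) :
    ∑ i, (Φ.tangentPower Δ n).coeff i i k l = 0 := by
  simp only [SuperOp.coeff, SuperOp.tangentPower, LinearMap.sum_apply, Matrix.sum_apply]
  rw [Finset.sum_comm]
  refine Finset.sum_eq_zero fun t _ => ?_
  refine (SuperOp.sum_coeff_tensor _ k l).trans (Finset.prod_eq_zero (Finset.mem_univ t) ?_)
  rw [Function.update_self]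
  exact hΔ.traceZero _

/-- States are preserved by maps with positive Choi matrix that preserve the trace, the latter
expressed by `∑ i, ⟨i| Φ(|k⟩⟨l|) |i⟩ = δ_kl`. -/
theorem IsState.ampliate [Fintype e] {Φ : SuperOp d e} (hΦ : Φ.choi.PosSemidef)
    (htr : ∀ k l, ∑ i, Φ.coeff i i k l = if k = l then 1 else 0)
    {κ : Type*} [Fintype κ] [DecidableEq κ] {ρ : Op (d × κ)} (hρ : IsState ρ) :
    IsState (Φ.ampliate κ ρ) where
  posSemidef := SuperOp.ampliate_posSemidef hΦ hρ.posSemidef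
  trace_eq_one := by
    rw [SuperOp.trace_ampliate, ← hρ.trace_eq_one]
    simp only [htr, Matrix.trace, Matrix.diag_apply, Fintype.sum_prod_type]
    rw [Finset.sum_comm]
    simp

theorem IsChannel.isState_power [Fintype e] {Φ : SuperOp d e} (hΦ : IsChannel Φ) {n : ℕ}
    {κ : Type*} [Fintype κ] [DecidableEq κ] {ρ : Op ((Fin n → d) × κ)} (hρ : IsState ρ) :
    IsState ((Φ.power n).ampliate κ ρ) :=
  hρ.ampliate (SuperOp.posSemidef_choi_power hΦ.posSemidef_choi n) (hΦ.sum_coeff_power n)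

theorem IsTangent.trace_tangentPower [Fintype e] {Δ : SuperOp d e} (hΔ : IsTangent Δ)
    (Φ : SuperOp d e) {n : ℕ} {κ : Type*} [Fintype κ] (ρ : Op ((Fin n → d) × κ)) :
    ((Φ.tangentPower Δ n).ampliate κ ρ).trace = 0 := by
  simp [SuperOp.trace_ampliate, hΔ.sum_coeff_tangentPower]

end coefficients

/-! ### Joining systems with ancillas -/

section append

/-- The regrouping of `m + n` systems with a joint ancilla into `m` and `n` systems, each with its
own ancilla. -/
def splitEquiv (d : Type*) (m n k l : ℕ) :
    (Fin (m + n) → d) × Fin (k * l) ≃ ((Fin m → d) × Fin k) × ((Fin n → d) × Fin l) :=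
  ((Fin.appendEquiv m n).symm.prodCongr finProdFinEquiv.symm).trans (Equiv.prodProdProdComm _ _ _ _)

variable {d e : Type*} {m n k l : ℕ}

/-- The tensor product of operators on `m` and `n` systems with ancillas, regrouped. -/
def append (X : Op ((Fin m → d) × Fin k)) (Y : Op ((Fin n → d) × Fin l)) :
    Op ((Fin (m + n) → d) × Fin (k * l)) :=
  (X ⊗ₖ Y).submatrix (splitEquiv d m n k l) (splitEquiv d m n k l)

theorem append_mul [Fintype d] (X X' : Op ((Fin m → d) × Fin k)) (Y Y' : Op ((Fin n → d) × Fin l)) :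
    append X Y * append X' Y' = append (X * X') (Y * Y') := by
  classical
  rw [append, append, Matrix.submatrix_mul_equiv, ← Matrix.mul_kronecker_mul, append]

theorem append_conjTranspose (X : Op ((Fin m → d) × Fin k)) (Y : Op ((Fin n → d) × Fin l)) :
    (append X Y)ᴴ = append Xᴴ Yᴴ := by
  rw [append, Matrix.conjTranspose_submatrix, Matrix.conjTranspose_kronecker, append]

theorem append_trace [Fintype d] (X : Op ((Fin m → d) × Fin k)) (Y : Op ((Fin n → d) × Fin l)) :
    (append X Y).trace = X.trace * Y.trace := by
  classical
  rw [← Matrix.trace_kronecker, append]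
  exact Equiv.sum_comp (splitEquiv d m n k l) fun x => (X ⊗ₖ Y) x x

@[simp]
theorem append_one_one [DecidableEq d] :
    append (1 : Op ((Fin m → d) × Fin k)) (1 : Op ((Fin n → d) × Fin l)) = 1 := by
  rw [append, Matrix.one_kronecker_one, Matrix.submatrix_one_equiv]

theorem append_sub_left (X X' : Op ((Fin m → d) × Fin k)) (Y : Op ((Fin n → d) × Fin l)) :
    append (X - X') Y = append X Y - append X' Y := by
  ext; simp [append, sub_mul]

theorem append_sub_right (X : Op ((Fin m → d) × Fin k)) (Y Y' : Op ((Fin n → d) × Fin l)) :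
    append X (Y - Y') = append X Y - append X Y' := by
  ext; simp [append, mul_sub]

theorem append_sum_left {ι : Type*} (s : Finset ι) (X : ι → Op ((Fin m → d) × Fin k))
    (Y : Op ((Fin n → d) × Fin l)) :
    append (∑ i ∈ s, X i) Y = ∑ i ∈ s, append (X i) Y := by
  ext; simp [append, Matrix.sum_apply, Finset.sum_mul]

theorem append_sum_right {ι : Type*} (s : Finset ι) (X : Op ((Fin m → d) × Fin k))
    (Y : ι → Op ((Fin n → d) × Fin l)) :
    append X (∑ i ∈ s, Y i) = ∑ i ∈ s, append X (Y i) := by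
  ext; simp [append, Matrix.sum_apply, Finset.mul_sum]

theorem append_posSemidef [Fintype d] {X : Op ((Fin m → d) × Fin k)}
    {Y : Op ((Fin n → d) × Fin l)} (hX : X.PosSemidef) (hY : Y.PosSemidef) :
    (append X Y).PosSemidef :=
  (hX.kronecker hY).submatrix _

theorem IsState.append [Fintype d] {X : Op ((Fin m → d) × Fin k)}
    {Y : Op ((Fin n → d) × Fin l)} (hX : IsState X) (hY : IsState Y) :
    IsState (append X Y) where
  posSemidef := append_posSemidef hX.posSemidef hY.posSemidef
  trace_eq_one := by rw [append_trace, hX.trace_eq_one, hY.trace_eq_one, mul_one]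

variable [Fintype d] [DecidableEq d]

theorem ampliate_tensor_append (Ψ : Fin m → SuperOp d e) (Ψ' : Fin n → SuperOp d e)
    (X : Op ((Fin m → d) × Fin k)) (Y : Op ((Fin n → d) × Fin l)) :
    (SuperOp.tensor (Fin.append Ψ Ψ')).ampliate (Fin (k * l)) (append X Y) =
      append ((SuperOp.tensor Ψ).ampliate (Fin k) X) ((SuperOp.tensor Ψ').ampliate (Fin l) Y) := by
  ext i j
  simp only [append, Matrix.submatrix_apply, Matrix.kroneckerMap_apply, SuperOp.ampliate_apply]
  rw [← Equiv.sum_comp (Fin.appendEquiv m n), Finset.sum_mul_sum, Fintype.sum_prod_type]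
  refine Finset.sum_congr rfl fun a _ => Finset.sum_congr rfl fun b _ => ?_
  rw [← Equiv.sum_comp (Fin.appendEquiv m n), Finset.sum_mul_sum, Fintype.sum_prod_type]
  refine Finset.sum_congr rfl fun a' _ => Finset.sum_congr rfl fun b' _ => ?_
  simp only [SuperOp.coeff_tensor, Fin.prod_univ_add, Fin.append_left, Fin.append_right,
    splitEquiv, Fin.appendEquiv]
  simp
  ring

theorem power_append (Φ : SuperOp d e) (X : Op ((Fin m → d) × Fin k))
    (Y : Op ((Fin n → d) × Fin l)) :
    (Φ.power (m + n)).ampliate (Fin (k * l)) (append X Y) =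
      append ((Φ.power m).ampliate (Fin k) X) ((Φ.power n).ampliate (Fin l) Y) := by
  have h : (fun _ : Fin (m + n) => Φ) = Fin.append (fun _ => Φ) (fun _ => Φ) := by
    ext1 t
    refine Fin.addCases (fun t => ?_) (fun t => ?_) t <;> simp
  rw [SuperOp.power, h, ampliate_tensor_append, SuperOp.power, SuperOp.power]

/-- The Leibniz rule for `Δ^{(m + n)}` on product inputs. -/
theorem tangentPower_append (Φ Δ : SuperOp d e) (X : Op ((Fin m → d) × Fin k))
    (Y : Op ((Fin n → d) × Fin l)) :
    (Φ.tangentPower Δ (m + n)).ampliate (Fin (k * l)) (append X Y) =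
      append ((Φ.tangentPower Δ m).ampliate (Fin k) X) ((Φ.power n).ampliate (Fin l) Y) +
      append ((Φ.power m).ampliate (Fin k) X) ((Φ.tangentPower Δ n).ampliate (Fin l) Y) := by
  have h₁ (s : Fin m) : Function.update (fun _ : Fin (m + n) => Φ) (Fin.castAdd n s) Δ =
      Fin.append (Function.update (fun _ => Φ) s Δ) (fun _ => Φ) := by
    ext1 t
    refine Fin.addCases (fun t => ?_) (fun t => ?_) t
    · simp [Function.update_apply]
    · rw [Fin.append_right, Function.update_of_ne]
      simp [Fin.ext_iff]; omega
  have h₂ (s : Fin n) : Function.update (fun _ : Fin (m + n) => Φ) (Fin.natAdd m s) Δ =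
      Fin.append (fun _ => Φ) (Function.update (fun _ => Φ) s Δ) := by
    ext1 t
    refine Fin.addCases (fun t => ?_) (fun t => ?_) t
    · rw [Fin.append_left, Function.update_of_ne]
      simp [Fin.ext_iff]; omega
    · simp [Function.update_apply]
  rw [SuperOp.tangentPower, Fin.sum_univ_add, SuperOp.ampliate_add]
  simp only [SuperOp.tangentPower, SuperOp.ampliate_sum, append_sum_left, append_sum_right,
    h₁, h₂, ampliate_tensor_append, SuperOp.power]

end append

/-! ### The RLD Fisher information -/

section RLD

variable {d : Type*} [Fintype d]

/-- The concave functional `T ↦ 2 Re tr (δ T†) - tr (T σ T†)`, whose supremum over all operators `T`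
is the RLD Fisher information. -/
def rldTest (σ δ T : Op d) : ℝ :=
  2 * (δ * Tᴴ).trace.re - (T * σ * Tᴴ).trace.re

theorem re_trace_nonneg {X : Op d} (hX : X.PosSemidef) : 0 ≤ X.trace.re :=
  (Complex.nonneg_iff.1 hX.trace_nonneg).1

theorem im_trace_eq_zero {X : Op d} (hX : X.PosSemidef) : X.trace.im = 0 :=
  (Complex.nonneg_iff.1 hX.trace_nonneg).2.symm

theorem trace_conjTranspose_sandwich {σ : Op d} (hσ : σ.IsHermitian) (S T : Op d) :
    (S * σ * Tᴴ).trace = star (T * σ * Sᴴ).trace := by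
  rw [← Matrix.trace_conjTranspose]
  simp [Matrix.conjTranspose_mul, hσ.eq, Matrix.mul_assoc]

theorem re_trace_sandwich_comm {σ : Op d} (hσ : σ.IsHermitian) (S T : Op d) :
    (S * σ * Tᴴ).trace.re = (T * σ * Sᴴ).trace.re := by
  rw [trace_conjTranspose_sandwich hσ]; simp

theorem rldTest_le_of_eq {σ δ L : Op d} (hσ : σ.PosSemidef) (hL : δ = L * σ) (T : Op d) :
    rldTest σ δ T ≤ (σ * Lᴴ * L).trace.re := by
  have h := re_trace_nonneg (hσ.mul_mul_conjTranspose_same (T - L))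
  have h1 := re_trace_sandwich_comm hσ.isHermitian T L
  have h2 : (σ * Lᴴ * L).trace = (L * σ * Lᴴ).trace := by
    rw [Matrix.trace_mul_comm, Matrix.mul_assoc]
  simp only [Matrix.conjTranspose_sub, Matrix.sub_mul, Matrix.mul_sub, Matrix.trace_sub,
    Complex.sub_re] at h
  rw [rldTest, hL, h2]
  linarith

theorem rldTest_le_fisherRLD {σ δ : Op d} (hσ : σ.PosSemidef) (T : Op d) :
    ENNReal.ofReal (rldTest σ δ T) ≤ fisherRLD σ δ :=
  le_iInf₂ fun _ hL => ENNReal.ofReal_le_ofReal (rldTest_le_of_eq hσ hL T)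

/-- The equation `δ = L σ` is solvable if `ker σ ⊆ ker δ`. -/
theorem exists_eq_mul_of_ker_le {σ δ : Op d} (h : ∀ v, σ *ᵥ v = 0 → δ *ᵥ v = 0) :
    ∃ L : Op d, δ = L * σ := by
  classical
  have hk : (Matrix.toLin' σ).ker ≤ (Matrix.toLin' δ).ker := fun v hv => by
    simpa using h v (by simpa using hv)
  obtain ⟨g, hg⟩ := ((Matrix.toLin' σ).ker.liftQ _ le_rfl).exists_leftInverse_of_injective
    (Submodule.ker_liftQ_eq_bot _ _ _ le_rfl)
  refine ⟨LinearMap.toMatrix' ((Submodule.liftQ _ _ hk) ∘ₗ g), ?_⟩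
  apply Matrix.toLin'.injective
  rw [Matrix.toLin'_mul, Matrix.toLin'_toMatrix']
  ext1 v
  ext1
  have := LinearMap.congr_fun hg ((Matrix.toLin' σ).ker.mkQ (Pi.single v 1))
  simp only [LinearMap.comp_apply, Submodule.mkQ_apply, Submodule.liftQ_apply,
    LinearMap.id_apply] at this
  simp only [LinearMap.comp_apply, LinearMap.single_apply]
  rw [this, Submodule.liftQ_apply]

theorem fisherRLD_le_of_rldTest_le {σ δ : Op d} {B : ℝ≥0∞}
    (h : ∀ T, ENNReal.ofReal (rldTest σ δ T) ≤ B) : fisherRLD σ δ ≤ B := by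
  by_cases hL : ∃ L : Op d, δ = L * σ
  · obtain ⟨L, hL⟩ := hL
    refine (iInf₂_le L hL).trans ((le_of_eq ?_).trans (h L))
    have h2 : (σ * Lᴴ * L).trace = (L * σ * Lᴴ).trace := by
      rw [Matrix.trace_mul_comm, Matrix.mul_assoc]
    rw [rldTest, ← hL, h2, ← hL]
    congr 1
    ring
  · -- A vector of the kernel of `σ` outside the kernel of `δ` yields arbitrarily large test values.
    have hv : ∃ v, σ *ᵥ v = 0 ∧ δ *ᵥ v ≠ 0 := by
      by_contra! hv
      exact hL (exists_eq_mul_of_ker_le hv)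
    obtain ⟨v, hv0, hv1⟩ := hv
    obtain ⟨W, hW0, hW⟩ : ∃ W : Op d, W * σ * Wᴴ = 0 ∧ 0 < (δ * Wᴴ).trace.re := by
      refine ⟨Matrix.vecMulVec (δ *ᵥ v) (star v), ?_, ?_⟩
      · rw [Matrix.conjTranspose_vecMulVec, star_star, Matrix.mul_assoc, Matrix.mul_vecMulVec, hv0]
        simp
      · rw [Matrix.conjTranspose_vecMulVec, star_star, Matrix.mul_vecMulVec,
          Matrix.trace_vecMulVec, dotProduct_comm]
        exact (Complex.pos_iff.1 (Matrix.dotProduct_star_self_pos_iff.2 hv1)).1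
    have ht (c : ℝ) : rldTest σ δ ((c : ℂ) • W) = 2 * c * (δ * Wᴴ).trace.re := by
      simp [rldTest, Matrix.conjTranspose_smul, hW0]
      ring
    suffices B = ⊤ by simp [this]
    by_contra hB
    have := h ((((B.toReal + 1) / (2 * (δ * Wᴴ).trace.re) : ℝ) : ℂ) • W)
    rw [ht, ENNReal.ofReal_le_iff_le_toReal hB] at this
    have h3 : 2 * ((B.toReal + 1) / (2 * (δ * Wᴴ).trace.re)) * (δ * Wᴴ).trace.re =
        B.toReal + 1 := by
      field_simp
    linarith

/-- Test operators may be taken centred, i.e. with `tr (T σ) = 0`. -/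
theorem exists_centred_rldTest_ge [DecidableEq d] {σ δ : Op d} (hσ : IsState σ) (hδ : δ.trace = 0)
    (T : Op d) :
    ∃ S : Op d, (S * σ).trace = 0 ∧ rldTest σ δ T ≤ rldTest σ δ S := by
  set a := (T * σ).trace with ha
  have hb : (σ * Tᴴ).trace = star a := by
    rw [ha, ← Matrix.trace_conjTranspose, Matrix.conjTranspose_mul, hσ.posSemidef.isHermitian.eq]
  refine ⟨T - a • 1, by simp [sub_mul, hσ.trace_eq_one, ← ha], ?_⟩
  have h : ((T - a • 1) * σ * (T - a • 1)ᴴ).trace = (T * σ * Tᴴ).trace - a * star a := by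
    simp [sub_mul, mul_sub, hσ.trace_eq_one, ← ha, hb]
  have h2 : (δ * (T - a • 1)ᴴ).trace = (δ * Tᴴ).trace := by
    simp [mul_sub, hδ]
  rw [rldTest, rldTest, h, h2]
  have : 0 ≤ (a * star a).re := by
    rw [RCLike.star_def, Complex.mul_conj, Complex.ofReal_re]
    exact Complex.normSq_nonneg a
  simp only [Complex.sub_re]
  linarith

/-- Centred test operators with nonnegative value suffice; the operator `0` has value `0`. -/
theorem exists_centred_rldTest_ge' [DecidableEq d] {σ δ : Op d} (hσ : IsState σ)
    (hδ : δ.trace = 0) (T : Op d) :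
    ∃ S : Op d, (S * σ).trace = 0 ∧ 0 ≤ rldTest σ δ S ∧ rldTest σ δ T ≤ rldTest σ δ S := by
  obtain ⟨S, hS, hle⟩ := exists_centred_rldTest_ge hσ hδ T
  rcases le_total 0 (rldTest σ δ S) with h | h
  · exact ⟨S, hS, h, hle⟩
  · exact ⟨0, by simp, by simp [rldTest], hle.trans (h.trans (by simp [rldTest]))⟩

theorem fisherRLD_eq_iSup {σ δ : Op d} (hσ : σ.PosSemidef) :
    fisherRLD σ δ = ⨆ T, ENNReal.ofReal (rldTest σ δ T) :=
  le_antisymm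
    (fisherRLD_le_of_rldTest_le fun T => le_iSup (fun T => ENNReal.ofReal (rldTest σ δ T)) T)
    (iSup_le fun T => rldTest_le_fisherRLD hσ T)

/-- Superadditivity of the RLD Fisher information on product states; the tests `T₁` and `T₂` combine
to `T₁ ⊗ 1 + 1 ⊗ T₂`, whose cross terms vanish for centred `T₁`, `T₂`. -/
theorem fisherRLD_kronecker_ge [DecidableEq d] {d' : Type*} [Fintype d'] [DecidableEq d']
    {σ δ : Op d} {σ' δ' : Op d'}
    (hσ : IsState σ) (hσ' : IsState σ') (hδ : δ.trace = 0) (hδ' : δ'.trace = 0) :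
    fisherRLD σ δ + fisherRLD σ' δ' ≤ fisherRLD (σ ⊗ₖ σ') (δ ⊗ₖ σ' + σ ⊗ₖ δ') := by
  rw [fisherRLD_eq_iSup hσ.posSemidef, fisherRLD_eq_iSup hσ'.posSemidef]
  refine ENNReal.iSup_add_iSup_le fun T T' => ?_
  obtain ⟨S, hS, hS0, hTS⟩ := exists_centred_rldTest_ge' hσ hδ T
  obtain ⟨S', hS', hS0', hTS'⟩ := exists_centred_rldTest_ge' hσ' hδ' T'
  refine (add_le_add (ENNReal.ofReal_le_ofReal hTS) (ENNReal.ofReal_le_ofReal hTS')).trans ?_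
  rw [← ENNReal.ofReal_add hS0 hS0']
  refine le_trans (ENNReal.ofReal_le_ofReal (le_of_eq ?_)) (rldTest_le_fisherRLD
    (hσ.posSemidef.kronecker hσ'.posSemidef) (S ⊗ₖ (1 : Op d') + (1 : Op d) ⊗ₖ S'))
  simp only [rldTest, Matrix.conjTranspose_add, Matrix.conjTranspose_kronecker,
    Matrix.conjTranspose_one, Matrix.add_mul, Matrix.mul_add, ← Matrix.mul_kronecker_mul,
    Matrix.trace_add, Matrix.trace_kronecker, Matrix.one_mul, Matrix.mul_one, hδ, hδ', hS, hS',
    hσ.trace_eq_one, hσ'.trace_eq_one, Complex.add_re]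
  simp
  ring

theorem fisherRLD_le_submatrix {d' : Type*} [Fintype d'] (f : d' ≃ d) (σ δ : Op d) :
    fisherRLD σ δ ≤ fisherRLD (σ.submatrix f f) (δ.submatrix f f) := by
  refine le_iInf₂ fun L hL => ?_
  have hL' : L = (L.submatrix f.symm f.symm).submatrix f f := by simp
  generalize L.submatrix f.symm f.symm = K at hL'
  rw [hL', Matrix.submatrix_mul_equiv] at hL
  refine (iInf₂_le K ?_).trans (le_of_eq ?_)
  · have := congrArg (fun M => M.submatrix f.symm f.symm) hL
    simpa using this
  · rw [hL', Matrix.conjTranspose_submatrix, Matrix.submatrix_mul_equiv,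
      Matrix.submatrix_mul_equiv]
    congr 2
    exact (Equiv.sum_comp f fun x => (σ * Kᴴ * K) x x).symm

theorem fisherRLD_append_ge [DecidableEq d] {m n k l : ℕ} {σ δ : Op ((Fin m → d) × Fin k)}
    {σ' δ' : Op ((Fin n → d) × Fin l)} (hσ : IsState σ) (hσ' : IsState σ') (hδ : δ.trace = 0)
    (hδ' : δ'.trace = 0) :
    fisherRLD σ δ + fisherRLD σ' δ' ≤
      fisherRLD (append σ σ') (append δ σ' + append σ δ') :=
  (fisherRLD_kronecker_ge hσ hσ' hδ hδ').trans
    (fisherRLD_le_submatrix (splitEquiv d m n k l) _ _)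

end RLD

/-! ### Measurements and the classical Fisher information -/

section classical

theorem re_trace_mul_nonneg {d : Type*} [Fintype d] [DecidableEq d] {M X : Op d}
    (hM : M.PosSemidef) (hX : X.PosSemidef) : 0 ≤ (M * X).trace.re := by
  obtain ⟨B, rfl⟩ := exists_eq_conjTranspose_mul_self hM
  rw [Matrix.mul_assoc, Matrix.trace_mul_comm]
  exact re_trace_nonneg (hX.mul_mul_conjTranspose_same B)

theorem im_trace_mul_eq_zero {d : Type*} [Fintype d] [DecidableEq d] {M X : Op d}
    (hM : M.PosSemidef) (hX : X.PosSemidef) : (M * X).trace.im = 0 := by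
  obtain ⟨B, rfl⟩ := exists_eq_conjTranspose_mul_self hM
  rw [Matrix.mul_assoc, Matrix.trace_mul_comm]
  exact im_trace_eq_zero (hX.mul_mul_conjTranspose_same B)

/-- `a² / p` is the supremum of `2 t a - t² p` over `t`, also for `p = 0` with the conventions of
`fisherFinite`. -/
theorem ofReal_sq_div_le {a p z : ℝ} (hp : 0 ≤ p) (h : ∀ t : ℝ, 2 * t * a - t ^ 2 * p ≤ z) :
    ENNReal.ofReal (a ^ 2) / ENNReal.ofReal p ≤ ENNReal.ofReal z := by
  rcases hp.eq_or_lt with rfl | hp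
  · have ha : a = 0 := by
      by_contra ha
      have := h ((z + 1) / (2 * a))
      have h3 : 2 * ((z + 1) / (2 * a)) * a = z + 1 := by field_simp
      rw [h3] at this
      linarith
    simp [ha]
  · rw [← ENNReal.ofReal_div_of_pos hp]
    refine ENNReal.ofReal_le_ofReal (le_trans (le_of_eq ?_) (h (a / p)))
    field_simp
    ring

/-- Measurement does not increase the RLD Fisher information. -/
theorem fisherFinite_outcome_le {d : Type*} [Fintype d] [DecidableEq d] {m : ℕ} {M : Fin m → Op d}
    (hM : IsPOVM M) {σ : Op d} (hσ : σ.PosSemidef) (δ : Op d) :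
    fisherFinite (outcome M σ) (outcome M δ) ≤ fisherRLD σ δ := by
  refine le_iInf₂ fun L hL => ?_
  have hLσ := hσ.mul_mul_conjTranspose_same L
  have hx (x : Fin m) : ENNReal.ofReal (outcome M δ x ^ 2) / ENNReal.ofReal (outcome M σ x) ≤
      ENNReal.ofReal (M x * (L * σ * Lᴴ)).trace.re := by
    refine ofReal_sq_div_le (re_trace_mul_nonneg (hM.posSemidef x) hσ) fun t => ?_
    -- `tr M_x (L - t) σ (L - t)† ≥ 0` for all `t` is the Cauchy-Schwarz inequality.
    have h := re_trace_mul_nonneg (hM.posSemidef x)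
      (hσ.mul_mul_conjTranspose_same (L - (t : ℂ) • 1))
    have h1 : (M x * (σ * Lᴴ)).trace = star (M x * (L * σ)).trace := by
      rw [← Matrix.trace_conjTranspose, Matrix.conjTranspose_mul, Matrix.conjTranspose_mul,
        hσ.isHermitian.eq, (hM.posSemidef x).isHermitian.eq, Matrix.trace_mul_comm]
    simp [sub_mul, mul_sub, h1] at h
    simp only [outcome, hL]
    nlinarith
  have h2 : (σ * Lᴴ * L).trace = ∑ x, (M x * (L * σ * Lᴴ)).trace := by
    rw [← Matrix.trace_sum, ← Finset.sum_mul, hM.sum_eq_one, one_mul, Matrix.trace_mul_comm,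
      Matrix.mul_assoc]
  rw [h2, Complex.re_sum, ENNReal.ofReal_sum_of_nonneg fun x _ =>
    re_trace_mul_nonneg (hM.posSemidef x) hLσ]
  exact Finset.sum_le_sum fun x _ => hx x

theorem fisherRLD_diagonal_le {α : Type*} [Fintype α] [DecidableEq α] {p δ : α → ℝ}
    (hp : ∀ x, 0 ≤ p x) :
    fisherRLD (Matrix.diagonal fun x => (p x : ℂ)) (Matrix.diagonal fun x => (δ x : ℂ)) ≤
      fisherFinite p δ := by
  by_cases h0 : ∃ x, p x = 0 ∧ δ x ≠ 0
  · -- The right-hand side is `∞`.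
    obtain ⟨x, hx, hδ⟩ := h0
    refine le_trans le_top (le_trans (le_of_eq ?_) (Finset.single_le_sum (f := fun x =>
      ENNReal.ofReal (δ x ^ 2) / ENNReal.ofReal (p x)) (fun _ _ => zero_le)
      (Finset.mem_univ x)))
    rw [hx, ENNReal.ofReal_zero, ENNReal.div_zero]
    simpa using by positivity
  · push Not at h0
    refine (iInf₂_le (Matrix.diagonal fun x => ((δ x / p x : ℝ) : ℂ)) ?_).trans (le_of_eq ?_)
    · rw [Matrix.diagonal_mul_diagonal]
      congr 1
      ext x
      by_cases hx : p x = 0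
      · simp [hx, h0 x hx]
      · push_cast
        rw [div_mul_cancel₀]
        exact_mod_cast hx
    · rw [Matrix.diagonal_conjTranspose, Matrix.diagonal_mul_diagonal,
        Matrix.diagonal_mul_diagonal, Matrix.trace_diagonal, Complex.re_sum,
        ENNReal.ofReal_sum_of_nonneg]
      · refine Finset.sum_congr rfl fun x _ => ?_
        have : ((p x : ℂ) * star (fun x => ((δ x / p x : ℝ) : ℂ)) x * ((δ x / p x : ℝ) : ℂ)).re
            = p x * (δ x / p x) * (δ x / p x) := by
          simp only [Pi.star_apply, RCLike.star_def, Complex.conj_ofReal]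
          rw [← Complex.ofReal_mul, ← Complex.ofReal_mul, Complex.ofReal_re]
        rw [this]
        rcases (hp x).eq_or_lt with hx | hx
        · simp [← hx, h0 x hx.symm]
        · rw [← ENNReal.ofReal_div_of_pos hx]
          congr 1
          field_simp
      · intro x _
        simp only [Pi.star_apply, RCLike.star_def, Complex.conj_ofReal]
        rw [← Complex.ofReal_mul, ← Complex.ofReal_mul, Complex.ofReal_re, mul_assoc]
        exact mul_nonneg (hp x) (mul_self_nonneg _)

theorem fisherFinite_le_fisherRLD_diagonal {m : ℕ} {p δ : Fin m → ℝ} (hp : ∀ x, 0 ≤ p x) :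
    fisherFinite p δ ≤
      fisherRLD (Matrix.diagonal fun x => (p x : ℂ)) (Matrix.diagonal fun x => (δ x : ℂ)) := by
  -- Measurement in the standard basis.
  have hM : IsPOVM fun x : Fin m => (Matrix.single x x 1 : Op (Fin m)) :=
    ⟨fun x => by
      rw [← Matrix.diagonal_single, Matrix.posSemidef_diagonal_iff]
      intro i
      by_cases h : i = x <;> simp [h],
    by simp [Matrix.sum_single_one]⟩
  have ho (q : Fin m → ℝ) :
      outcome (fun x : Fin m => (Matrix.single x x 1 : Op (Fin m)))
        (Matrix.diagonal fun x => (q x : ℂ)) = q := by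
    ext x
    simp [outcome, ← Matrix.diagonal_single, Matrix.diagonal_mul_diagonal, Pi.single_apply]
  have := fisherFinite_outcome_le hM (σ := Matrix.diagonal fun x => (p x : ℂ))
    (Matrix.posSemidef_diagonal_iff.2 fun i => by exact_mod_cast hp i)
    (Matrix.diagonal fun x => (δ x : ℂ))
  rwa [ho, ho] at this

/-- Superadditivity of the classical Fisher information on product distributions, obtained from the
quantum statement for diagonal operators. -/
theorem fisherFinite_prod_ge {m m' : ℕ} {p δ : Fin m → ℝ} {p' δ' : Fin m' → ℝ}
    (hp : ∀ x, 0 ≤ p x) (hp' : ∀ x, 0 ≤ p' x) (h1 : ∑ x, p x = 1) (h1' : ∑ x, p' x = 1)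
    (h0 : ∑ x, δ x = 0) (h0' : ∑ x, δ' x = 0) :
    fisherFinite p δ + fisherFinite p' δ' ≤
      fisherFinite (fun x : Fin m × Fin m' => p x.1 * p' x.2)
        (fun x => δ x.1 * p' x.2 + p x.1 * δ' x.2) := by
  have hs {n : ℕ} {q : Fin n → ℝ} (hq : ∀ x, 0 ≤ q x) (hq1 : ∑ x, q x = 1) :
      IsState (Matrix.diagonal fun x => (q x : ℂ)) :=
    ⟨Matrix.posSemidef_diagonal_iff.2 fun i => by exact_mod_cast hq i, by
      rw [Matrix.trace_diagonal]; exact_mod_cast hq1⟩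
  refine (add_le_add (fisherFinite_le_fisherRLD_diagonal hp)
    (fisherFinite_le_fisherRLD_diagonal hp')).trans ?_
  refine (fisherRLD_kronecker_ge (hs hp h1) (hs hp' h1') ?_ ?_).trans ?_
  · rw [Matrix.trace_diagonal]; exact_mod_cast h0
  · rw [Matrix.trace_diagonal]; exact_mod_cast h0'
  · refine le_trans (le_of_eq ?_)
      (fisherRLD_diagonal_le fun x : Fin m × Fin m' => mul_nonneg (hp x.1) (hp' x.2))
    simp only [Matrix.diagonal_kronecker_diagonal, Matrix.diagonal_add]
    push_cast
    rfl

end classical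

/-! ### Superadditive sequences -/

section Fekete

theorem tendsto_natDiv_div {m : ℕ} (hm : 0 < m) :
    Tendsto (fun n : ℕ => ((n / m : ℕ) : ℝ) / n) atTop (𝓝 (m : ℝ)⁻¹) := by
  have h := (tendsto_nat_floor_mul_div_atTop (R := ℝ) (a := (m : ℝ)⁻¹) (by positivity)).comp
    tendsto_natCast_atTop_atTop
  refine h.congr fun n => ?_
  rw [Function.comp_apply, inv_mul_eq_div, Nat.floor_div_eq_div]

theorem le_of_superadditive {u : ℕ → ℝ≥0∞} (h : ∀ m n, u m + u n ≤ u (m + n)) (m n : ℕ) :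
    (n / m : ℕ) * u m ≤ u n := by
  have h2 (k : ℕ) : k * u m ≤ u (m * k) := by
    induction k with
    | zero => simp
    | succ k ih =>
      rw [Nat.mul_succ, Nat.cast_succ, add_mul, one_mul]
      exact (add_le_add_left ih _).trans (h _ _)
  calc _ ≤ u (m * (n / m)) := h2 _
    _ ≤ u (m * (n / m)) + u (n % m) := le_self_add
    _ ≤ u (m * (n / m) + n % m) := h _ _
    _ = u n := by rw [Nat.div_add_mod]

/-- Fekete's lemma with values in `[0, ∞]`. -/
theorem tendsto_div_of_superadditive {u : ℕ → ℝ≥0∞} (h : ∀ m n, u m + u n ≤ u (m + n)) :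
    Tendsto (fun n => u n / (n : ℝ≥0∞)) atTop
      (𝓝 (limsup (fun n => u n / (n : ℝ≥0∞)) atTop)) := by
  have key (m : ℕ) (hm : 0 < m) :
      u m / (m : ℝ≥0∞) ≤ liminf (fun n => u n / (n : ℝ≥0∞)) atTop := by
    have h1 : Tendsto (fun n : ℕ => ENNReal.ofReal (((n / m : ℕ) : ℝ) / n) * u m) atTop
        (𝓝 (u m / m)) := by
      have := ENNReal.Tendsto.mul_const (b := u m)
        (ENNReal.tendsto_ofReal (tendsto_natDiv_div hm)) (Or.inl (by simpa using hm.ne'))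
      rwa [ENNReal.ofReal_inv_of_pos (by positivity), ENNReal.ofReal_natCast, mul_comm] at this
    rw [← h1.liminf_eq]
    refine liminf_le_liminf ?_
    filter_upwards [eventually_gt_atTop 0] with n hn
    rw [ENNReal.ofReal_div_of_pos (by positivity), ENNReal.ofReal_natCast, ENNReal.ofReal_natCast,
      mul_comm, ← mul_div_assoc, mul_comm]
    exact ENNReal.div_le_div_right (le_of_superadditive h m n) _
  refine tendsto_of_le_liminf_of_limsup_le ?_ le_rfl
  refine limsup_le_of_le (by isBoundedDefault) ?_
  filter_upwards [eventually_gt_atTop 0] with m hm using key m hm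

end Fekete

/-! ### Superadditivity and existence of the limits -/

section superadditivity

variable {d e : Type*} [Fintype d] [DecidableEq d] [Fintype e] [DecidableEq e]

/-- Input states of a channel, together with an ancilla. -/
abbrev StateWithAncilla (d : Type*) [Fintype d] := Σ k : ℕ, {ρ : Op (d × Fin k) // IsState ρ}

instance StateWithAncilla.instNonempty [Nonempty d] : Nonempty (StateWithAncilla d) := by
  obtain ⟨i⟩ := ‹Nonempty d›
  exact ⟨1, Matrix.single (i, 0) (i, 0) 1, by
    rw [← Matrix.diagonal_single, Matrix.posSemidef_diagonal_iff]
    intro j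
    rw [Pi.single_apply]
    split_ifs <;> simp, by simp⟩

instance StateWithAncilla.instIsEmpty [IsEmpty d] : IsEmpty (StateWithAncilla d) :=
  ⟨fun ⟨_, ρ, hρ⟩ => by simpa [Matrix.trace] using hρ.trace_eq_one⟩

theorem GR_eq_iSup {d e : Type*} [Fintype d] [Fintype e] (Φ Δ : SuperOp d e) :
    GR Φ Δ = ⨆ x : StateWithAncilla d,
      fisherRLD (Φ.ampliate (Fin x.1) x.2.1) (Δ.ampliate (Fin x.1) x.2.1) := by
  simp only [GR, iSup_sigma, iSup_subtype]

/-- Measurements with finitely many outcomes, with the number of outcomes. -/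
abbrev FinPOVM (d : Type*) [Fintype d] [DecidableEq d] := Σ m : ℕ, {M : Fin m → Op d // IsPOVM M}

instance FinPOVM.instNonempty : Nonempty (FinPOVM d) :=
  ⟨1, fun _ => 1, fun _ => Matrix.PosSemidef.one, by simp⟩

theorem Gmin_eq_iSup {d e : Type*} [Fintype d] [Fintype e] [DecidableEq e] (Φ Δ : SuperOp d e) :
    Gmin Φ Δ = ⨆ x : Σ x : StateWithAncilla d, FinPOVM (e × Fin x.1),
      fisherFinite (outcome x.2.2.1 (Φ.ampliate (Fin x.1.1) x.1.2.1))
        (outcome x.2.2.1 (Δ.ampliate (Fin x.1.1) x.1.2.1)) := by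
  simp only [Gmin, iSup_sigma, iSup_subtype]

variable {Φ Δ : SuperOp d e}

theorem GR_superadditive [Nonempty d] (hΦ : IsChannel Φ) (hΔ : IsTangent Δ) (m n : ℕ) :
    GR (Φ.power m) (Φ.tangentPower Δ m) + GR (Φ.power n) (Φ.tangentPower Δ n) ≤
      GR (Φ.power (m + n)) (Φ.tangentPower Δ (m + n)) := by
  rw [GR_eq_iSup, GR_eq_iSup, GR_eq_iSup]
  refine ENNReal.iSup_add_iSup_le fun ⟨k, ρ, hρ⟩ ⟨l, ρ', hρ'⟩ => ?_
  refine le_trans ?_ (le_iSup _ (⟨k * l, append ρ ρ', hρ.append hρ'⟩ :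
    StateWithAncilla (Fin (m + n) → d)))
  simp only [power_append, tangentPower_append]
  exact fisherRLD_append_ge (hΦ.isState_power hρ) (hΦ.isState_power hρ')
    (hΔ.trace_tangentPower Φ ρ) (hΔ.trace_tangentPower Φ ρ')

theorem outcome_nonneg {m : ℕ} {M : Fin m → Op d} (hM : IsPOVM M) {σ : Op d} (hσ : σ.PosSemidef)
    (x : Fin m) : 0 ≤ outcome M σ x :=
  re_trace_mul_nonneg (hM.posSemidef x) hσ

theorem sum_outcome {m : ℕ} {M : Fin m → Op d} (hM : IsPOVM M) (σ : Op d) :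
    ∑ x, outcome M σ x = σ.trace.re := by
  simp only [outcome]
  rw [← Complex.re_sum, ← Matrix.trace_sum, ← Finset.sum_mul, hM.sum_eq_one, one_mul]

/-- The product measurement of two measurements. -/
def appendPOVM {m n k l a b : ℕ} (M : Fin a → Op ((Fin m → e) × Fin k))
    (M' : Fin b → Op ((Fin n → e) × Fin l)) (x : Fin (a * b)) :
    Op ((Fin (m + n) → e) × Fin (k * l)) :=
  append (M (finProdFinEquiv.symm x).1) (M' (finProdFinEquiv.symm x).2)

theorem IsPOVM.append {m n k l a b : ℕ} {M : Fin a → Op ((Fin m → e) × Fin k)}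
    {M' : Fin b → Op ((Fin n → e) × Fin l)} (hM : IsPOVM M) (hM' : IsPOVM M') :
    IsPOVM (appendPOVM M M') where
  posSemidef x := append_posSemidef (hM.posSemidef _) (hM'.posSemidef _)
  sum_eq_one := by
    simp only [appendPOVM]
    rw [Equiv.sum_comp finProdFinEquiv.symm fun x => QChannel.append (M x.1) (M' x.2),
      Fintype.sum_prod_type]
    simp only [← append_sum_right, ← append_sum_left, hM.sum_eq_one, hM'.sum_eq_one,
      append_one_one]

theorem fisherFinite_append_ge {m n k l a b : ℕ} {M : Fin a → Op ((Fin m → e) × Fin k)}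
    {M' : Fin b → Op ((Fin n → e) × Fin l)} (hM : IsPOVM M) (hM' : IsPOVM M')
    {σ δ : Op ((Fin m → e) × Fin k)} {σ' δ' : Op ((Fin n → e) × Fin l)}
    (hσ : IsState σ) (hσ' : IsState σ') (hδ : δ.trace = 0) (hδ' : δ'.trace = 0) :
    fisherFinite (outcome M σ) (outcome M δ) + fisherFinite (outcome M' σ') (outcome M' δ') ≤
      fisherFinite (outcome (appendPOVM M M') (append σ σ'))
        (outcome (appendPOVM M M') (append δ σ' + append σ δ')) := by
  refine (fisherFinite_prod_ge (outcome_nonneg hM hσ.posSemidef)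
    (outcome_nonneg hM' hσ'.posSemidef) ?_ ?_ ?_ ?_).trans (le_of_eq ?_)
  · rw [sum_outcome hM, hσ.trace_eq_one, Complex.one_re]
  · rw [sum_outcome hM', hσ'.trace_eq_one, Complex.one_re]
  · rw [sum_outcome hM, hδ, Complex.zero_re]
  · rw [sum_outcome hM', hδ', Complex.zero_re]
  · have h1 (x : Fin a × Fin b) :
        outcome (appendPOVM M M') (append σ σ') (finProdFinEquiv x) =
          outcome M σ x.1 * outcome M' σ' x.2 := by
      simp [outcome, appendPOVM, append_mul, append_trace,
        im_trace_mul_eq_zero (hM.posSemidef _) hσ.posSemidef]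
    have h2 (x : Fin a × Fin b) :
        outcome (appendPOVM M M') (append δ σ' + append σ δ') (finProdFinEquiv x) =
          outcome M δ x.1 * outcome M' σ' x.2 + outcome M σ x.1 * outcome M' δ' x.2 := by
      simp [outcome, appendPOVM, append_mul, append_trace, mul_add,
        im_trace_mul_eq_zero (hM.posSemidef _) hσ.posSemidef,
        im_trace_mul_eq_zero (hM'.posSemidef _) hσ'.posSemidef]
    rw [fisherFinite, fisherFinite, ← Equiv.sum_comp finProdFinEquiv]
    simp only [h1, h2]

theorem Gmin_superadditive [Nonempty d] (hΦ : IsChannel Φ) (hΔ : IsTangent Δ) (m n : ℕ) :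
    Gmin (Φ.power m) (Φ.tangentPower Δ m) + Gmin (Φ.power n) (Φ.tangentPower Δ n) ≤
      Gmin (Φ.power (m + n)) (Φ.tangentPower Δ (m + n)) := by
  have (n : ℕ) : Nonempty (Σ x : StateWithAncilla (Fin n → d), FinPOVM ((Fin n → e) × Fin x.1)) :=
    ⟨Classical.arbitrary _, Classical.arbitrary _⟩
  rw [Gmin_eq_iSup, Gmin_eq_iSup, Gmin_eq_iSup]
  refine ENNReal.iSup_add_iSup_le fun ⟨⟨k, ρ, hρ⟩, ⟨a, M, hM⟩⟩ ⟨⟨l, ρ', hρ'⟩, ⟨b, M', hM'⟩⟩ => ?_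
  refine le_trans ?_ (le_iSup _ (⟨⟨k * l, append ρ ρ', hρ.append hρ'⟩,
    ⟨a * b, appendPOVM M M', hM.append hM'⟩⟩ :
    Σ x : StateWithAncilla (Fin (m + n) → d), FinPOVM ((Fin (m + n) → e) × Fin x.1)))
  simp only [power_append, tangentPower_append]
  exact fisherFinite_append_ge hM hM' (hΦ.isState_power hρ) (hΦ.isState_power hρ')
    (hΔ.trace_tangentPower Φ ρ) (hΔ.trace_tangentPower Φ ρ')

theorem Gmin_le_GR (hΦ : IsChannel Φ) (n : ℕ) :
    Gmin (Φ.power n) (Φ.tangentPower Δ n) ≤ GR (Φ.power n) (Φ.tangentPower Δ n) := by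
  rw [GR_eq_iSup, Gmin_eq_iSup]
  refine iSup_le fun ⟨⟨k, ρ, hρ⟩, ⟨a, M, hM⟩⟩ => ?_
  refine (fisherFinite_outcome_le hM (hΦ.isState_power hρ).posSemidef _).trans ?_
  exact le_iSup (fun x : StateWithAncilla (Fin n → d) =>
    fisherRLD ((Φ.power n).ampliate (Fin x.1) x.2.1)
      ((Φ.tangentPower Δ n).ampliate (Fin x.1) x.2.1)) ⟨k, ρ, hρ⟩

theorem GR_eq_zero_of_isEmpty {d e : Type*} [Fintype d] [DecidableEq d] [Fintype e]
    {Φ Δ : SuperOp d e} [IsEmpty d] {n : ℕ} (hn : 0 < n) :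
    GR (Φ.power n) (Φ.tangentPower Δ n) = 0 := by
  have : IsEmpty (Fin n → d) := ⟨fun f => isEmptyElim (f ⟨0, hn⟩)⟩
  rw [GR_eq_iSup, iSup_of_empty, bot_eq_zero]

theorem tendsto_rateR (hΦ : IsChannel Φ) (hΔ : IsTangent Δ) :
    Tendsto (rateR Φ Δ) atTop (𝓝 (GpR Φ Δ)) := by
  cases isEmpty_or_nonempty d with
  | inl _ =>
    have h : Tendsto (rateR Φ Δ) atTop (𝓝 0) := by
      refine tendsto_const_nhds.congr' ?_
      filter_upwards [eventually_gt_atTop 0] with n hn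
      rw [rateR, GR_eq_zero_of_isEmpty hn, ENNReal.zero_div]
    rwa [GpR, h.limsup_eq]
  | inr _ => exact tendsto_div_of_superadditive (GR_superadditive hΦ hΔ)

theorem tendsto_rateMin (hΦ : IsChannel Φ) (hΔ : IsTangent Δ) :
    Tendsto (rateMin Φ Δ) atTop (𝓝 (GpMin Φ Δ)) := by
  cases isEmpty_or_nonempty d with
  | inl _ =>
    have h : Tendsto (rateMin Φ Δ) atTop (𝓝 0) := by
      refine tendsto_const_nhds.congr' ?_
      filter_upwards [eventually_gt_atTop 0] with n hn
      have := (Gmin_le_GR hΦ n).trans_eq (GR_eq_zero_of_isEmpty (Φ := Φ) (Δ := Δ) hn)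
      rw [rateMin, nonpos_iff_eq_zero.1 this, ENNReal.zero_div]
    rwa [GpMin, h.limsup_eq]
  | inr _ => exact tendsto_div_of_superadditive (Gmin_superadditive hΦ hΔ)

theorem GpMin_le_GpR (hΦ : IsChannel Φ) : GpMin Φ Δ ≤ GpR Φ Δ :=
  limsup_le_limsup (Eventually.of_forall fun n => ENNReal.div_le_div_right (Gmin_le_GR hΦ n) _)

end superadditivity

/-! ### Trace norm and operator norm -/

section traceNorm

variable {d : Type*} [Fintype d] [DecidableEq d]

theorem trace_eq_sum_dotProduct (X : Op d) (b : OrthonormalBasis d ℂ (EuclideanSpace ℂ d)) :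
    X.trace = ∑ i, star (b i).ofLp ⬝ᵥ X *ᵥ (b i).ofLp := by
  have h := LinearMap.trace_eq_sum_inner (Matrix.toEuclideanLin X) b
  have h2 : LinearMap.trace ℂ _ (Matrix.toEuclideanLin X) = X.trace := by
    rw [Matrix.toEuclideanLin_eq_toLin_orthonormal, Matrix.trace_toLin_eq]
  rw [← h2, h]
  refine Finset.sum_congr rfl fun i _ => ?_
  rw [EuclideanSpace.inner_eq_star_dotProduct, dotProduct_comm]
  rfl

open scoped Matrix.Norms.L2Operator in
/-- Duality of the operator norm and the trace norm. -/
theorem norm_trace_mul_le (A X : Op d) : ‖(A * X).trace‖ ≤ ‖A‖ * traceNorm X := by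
  set hX := Matrix.isHermitian_conjTranspose_mul_self X
  rw [trace_eq_sum_dotProduct _ hX.eigenvectorBasis, traceNorm, Finset.mul_sum]
  refine (norm_sum_le _ _).trans (Finset.sum_le_sum fun i _ => ?_)
  set b := hX.eigenvectorBasis i with hb
  have hb1 : ‖b‖ = 1 := hX.eigenvectorBasis.orthonormal.1 i
  have h1 : star b.ofLp ⬝ᵥ (A * X) *ᵥ b.ofLp =
      inner ℂ b (WithLp.toLp 2 (A *ᵥ (X *ᵥ b.ofLp))) := by
    rw [EuclideanSpace.inner_eq_star_dotProduct, dotProduct_comm, Matrix.mulVec_mulVec]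
  have h2 : ‖WithLp.toLp 2 (X *ᵥ b.ofLp)‖ = √(hX.eigenvalues i) := by
    have h3 : (Xᴴ * X) *ᵥ b.ofLp = hX.eigenvalues i • b.ofLp := hX.mulVec_eigenvectorBasis i
    have h4 : inner ℂ (WithLp.toLp 2 (X *ᵥ b.ofLp)) (WithLp.toLp 2 (X *ᵥ b.ofLp)) =
        ((hX.eigenvalues i : ℝ) : ℂ) := by
      rw [EuclideanSpace.inner_eq_star_dotProduct, dotProduct_comm, Matrix.star_mulVec,
        ← Matrix.dotProduct_mulVec, Matrix.mulVec_mulVec, h3, dotProduct_smul, dotProduct_comm,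
        ← EuclideanSpace.inner_eq_star_dotProduct, inner_self_eq_norm_sq_to_K, hb1]
      simp
    rw [inner_self_eq_norm_sq_to_K] at h4
    rw [← Real.sqrt_sq (norm_nonneg (WithLp.toLp 2 (X *ᵥ b.ofLp)))]
    congr 1
    exact Complex.ofReal_injective (by rw [← h4]; simp)
  rw [h1]
  calc _ ≤ ‖b‖ * ‖WithLp.toLp 2 (A *ᵥ (X *ᵥ b.ofLp))‖ := norm_inner_le_norm _ _
    _ ≤ 1 * (‖A‖ * ‖WithLp.toLp 2 (X *ᵥ b.ofLp)‖) := by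
      rw [hb1]
      gcongr
      exact Matrix.l2_opNorm_mulVec A (WithLp.toLp 2 (X *ᵥ b.ofLp))
    _ = _ := by rw [h2, one_mul]

/-- An eigenvector of the square of a positive operator is an eigenvector of the operator. -/
theorem mulVec_eq_smul_of_sq {d : Type*} [Fintype d] {ρ : Op d} (hρ : ρ.PosSemidef)
    {r : ℝ} (hr : 0 ≤ r) {v : d → ℂ} (h : ρ *ᵥ (ρ *ᵥ v) = ((r : ℂ) ^ 2) • v) : ρ *ᵥ v = (r : ℂ) • v := by
  rcases hr.eq_or_lt with rfl | hr
  · simp only [Complex.ofReal_zero, ne_eq, OfNat.ofNat_ne_zero, not_false_eq_true, zero_pow,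
      zero_smul] at h ⊢
    rw [← dotProduct_star_self_eq_zero, Matrix.star_mulVec,
      ← Matrix.dotProduct_mulVec, hρ.isHermitian.eq, h, dotProduct_zero]
  · -- `w = (ρ - r) v` satisfies `⟨w, ρ w⟩ + r ⟨w, w⟩ = 0`.
    set w := ρ *ᵥ v - (r : ℂ) • v with hw
    have h1 : ρ *ᵥ w + (r : ℂ) • w = 0 := by
      rw [hw, Matrix.mulVec_sub, h, Matrix.mulVec_smul]
      module
    have h2 : star w ⬝ᵥ ρ *ᵥ w + (r : ℂ) * (star w ⬝ᵥ w) = 0 := by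
      rw [← smul_eq_mul, ← dotProduct_smul, ← dotProduct_add, h1, dotProduct_zero]
    have h3 := hρ.dotProduct_mulVec_nonneg w
    have h4 : 0 ≤ star w ⬝ᵥ w := dotProduct_star_self_nonneg w
    have h5 : (0 : ℂ) < r := by exact_mod_cast hr
    have h6 : (r : ℂ) * (star w ⬝ᵥ w) = 0 :=
      ((add_eq_zero_iff_of_nonneg h3 (mul_nonneg h5.le h4)).1 h2).2
    have h7 : star w ⬝ᵥ w = 0 := (mul_eq_zero.1 h6).resolve_left h5.ne'
    exact sub_eq_zero.1 (dotProduct_star_self_eq_zero.1 h7)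

theorem traceNorm_of_posSemidef {ρ : Op d} (hρ : ρ.PosSemidef) : (traceNorm ρ : ℂ) = ρ.trace := by
  set hX := Matrix.isHermitian_conjTranspose_mul_self ρ
  rw [trace_eq_sum_dotProduct _ hX.eigenvectorBasis, traceNorm, Complex.ofReal_sum]
  refine Finset.sum_congr rfl fun i _ => ?_
  have h0 : 0 ≤ hX.eigenvalues i :=
    (Matrix.posSemidef_conjTranspose_mul_self ρ).eigenvalues_nonneg i
  have h1 := hX.mulVec_eigenvectorBasis i
  have hb1 : ‖hX.eigenvectorBasis i‖ = 1 := hX.eigenvectorBasis.orthonormal.1 i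
  have h2 := mulVec_eq_smul_of_sq hρ (Real.sqrt_nonneg (hX.eigenvalues i))
    (v := (hX.eigenvectorBasis i).ofLp) (by
      rw [Matrix.mulVec_mulVec, ← Complex.ofReal_pow, Real.sq_sqrt h0, Complex.coe_smul, ← h1]
      exact congrArg (fun A => (A * ρ) *ᵥ (hX.eigenvectorBasis i).ofLp) hρ.isHermitian.eq.symm)
  rw [h2, dotProduct_smul, dotProduct_comm, ← EuclideanSpace.inner_eq_star_dotProduct,
    inner_self_eq_norm_sq_to_K, hb1]
  simp

theorem traceNorm_of_isState {ρ : Op d} (hρ : IsState ρ) : traceNorm ρ = 1 := by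
  have := traceNorm_of_posSemidef hρ.posSemidef
  rw [hρ.trace_eq_one] at this
  exact_mod_cast this

theorem traceNorm_ampliate_le {e : Type*} [Fintype e] [DecidableEq e] (Ψ : SuperOp d e) {k : ℕ}
    {ρ : Op (d × Fin k)} (hρ : IsState ρ) (h : cbNorm Ψ ≠ ⊤) :
    traceNorm (Ψ.ampliate (Fin k) ρ) ≤ (cbNorm Ψ).toReal := by
  rw [← ENNReal.ofReal_le_iff_le_toReal h, cbNorm]
  exact le_iSup_of_le k (le_iSup₂_of_le ρ (traceNorm_of_isState hρ).le le_rfl)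

open scoped Matrix.Norms.L2Operator MatrixOrder in
theorem norm_le_sqrt_of_posSemidef {A : Op d} {c : ℝ} (hc : 0 ≤ c)
    (h : ((c : ℂ) • 1 - A * Aᴴ).PosSemidef) : ‖A‖ ≤ √c := by
  have h1 : A * Aᴴ ≤ algebraMap ℝ (Op d) c := by
    rw [Matrix.le_iff, Algebra.algebraMap_eq_smul_one]
    exact h
  have h2 : ‖A * Aᴴ‖ ≤ c := (CStarAlgebra.norm_le_iff_le_algebraMap _ hc
    (Matrix.posSemidef_self_mul_conjTranspose A).nonneg).2 h1
  have h3 := Matrix.l2_opNorm_conjTranspose_mul_self Aᴴ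
  rw [Matrix.conjTranspose_conjTranspose, Matrix.l2_opNorm_conjTranspose] at h3
  exact Real.le_sqrt_of_sq_le (by rw [sq, ← h3]; exact h2)

end traceNorm

/-! ### Monotonicity under simulations -/

section simulation

variable {d e : Type*} [Fintype d] [DecidableEq d] [Fintype e] [DecidableEq e]

theorem norm_apply_le_of_posSemidef {C : Op d} (hC : C.PosSemidef) (x y : d) :
    ‖C x y‖ ≤ ((C x x).re + (C y y).re) / 2 := by
  obtain ⟨B, rfl⟩ := exists_eq_conjTranspose_mul_self hC
  simp only [Matrix.mul_apply, Matrix.conjTranspose_apply, RCLike.star_def,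
    Complex.re_sum, ← Finset.sum_add_distrib, Finset.sum_div]
  refine (norm_sum_le _ _).trans (Finset.sum_le_sum fun r _ => ?_)
  have h (z : ℂ) : ((starRingEnd ℂ) z * z).re = ‖z‖ ^ 2 := by
    rw [mul_comm, Complex.mul_conj, Complex.ofReal_re, Complex.normSq_eq_norm_sq]
  rw [norm_mul, RCLike.norm_conj, h, h]
  nlinarith [sq_nonneg (‖B r x‖ - ‖B r y‖)]

theorem IsChannel.norm_coeff_le {Φ : SuperOp d e} (hΦ : IsChannel Φ) (i j : e) (k l : d) :
    ‖Φ.coeff i j k l‖ ≤ 1 := by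
  have h (i : e) (k : d) : (Φ.choi (i, k) (i, k)).re ≤ 1 := by
    have h1 : ∑ i, Φ.choi (i, k) (i, k) = 1 :=
      (hΦ.sum_coeff k k).trans (if_pos rfl)
    rw [← Complex.one_re, ← h1, Complex.re_sum]
    exact Finset.single_le_sum (f := fun i => (Φ.choi (i, k) (i, k)).re)
      (fun i _ => (Complex.nonneg_iff.1 hΦ.posSemidef_choi.diag_nonneg).1) (Finset.mem_univ i)
  have := norm_apply_le_of_posSemidef hΦ.posSemidef_choi (i, k) (j, l)
  have h3 := h i k
  have h4 := h j l
  simp only [SuperOp.choi, Matrix.of_apply] at this h3 h4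
  linarith

theorem IsHybridChannel.integrable_coeff {Λ : ℝ → SuperOp d e} (hΛ : IsHybridChannel Λ)
    {q : Measure ℝ} {s : ℝ → ℝ} (hs : Integrable s q) (i j : e) (k l : d) :
    Integrable (fun x => (s x : ℂ) * (Λ x).coeff i j k l) q :=
  hs.ofReal.mul_bdd (hΛ.measurable (Matrix.single k l 1) i j).aestronglyMeasurable
    (Eventually.of_forall fun x => (hΛ.isChannel x).norm_coeff_le i j k l)

theorem integrable_and_ampliate_feed_eq {Λ : ℝ → SuperOp d e} (hΛ : IsHybridChannel Λ)
    {q : Measure ℝ} {s : ℝ → ℝ} (hs : Integrable s q) {κ : Type*} (ρ : Op (d × κ))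
    (i j : e × κ) :
    Integrable (fun x => (s x : ℂ) * (Λ x).ampliate κ ρ i j) q ∧
      (feed Λ q s).ampliate κ ρ i j = ∫ x, (s x : ℂ) * (Λ x).ampliate κ ρ i j ∂q := by
  have h (k l : d) := (hΛ.integrable_coeff hs i.1 j.1 k l).mul_const (ρ (k, i.2) (l, j.2))
  simp only [SuperOp.ampliate_apply, Finset.mul_sum, ← mul_assoc]
  refine ⟨integrable_finsetSum _ fun k _ => integrable_finsetSum _ fun l _ => h k l, ?_⟩
  rw [integral_finsetSum _ fun k _ => integrable_finsetSum _ fun l _ => h k l]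
  refine Finset.sum_congr rfl fun k _ => ?_
  rw [integral_finsetSum _ fun l _ => h k l]
  refine Finset.sum_congr rfl fun l _ => ?_
  rw [integral_mul_const, feed, SuperOp.coeff_ofCoeff]

theorem integrable_and_trace_feed_eq {Λ : ℝ → SuperOp d e} (hΛ : IsHybridChannel Λ)
    {q : Measure ℝ} {s : ℝ → ℝ} (hs : Integrable s q) {κ : Type*} [Fintype κ] (ρ : Op (d × κ))
    (F : Op (e × κ)) :
    Integrable (fun x => (s x : ℂ) * (F * (Λ x).ampliate κ ρ).trace) q ∧
      (F * (feed Λ q s).ampliate κ ρ).trace =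
        ∫ x, (s x : ℂ) * (F * (Λ x).ampliate κ ρ).trace ∂q := by
  have h (i j : e × κ) := ((integrable_and_ampliate_feed_eq hΛ hs ρ j i).1).const_mul (F i j)
  simp only [Matrix.trace, Matrix.diag_apply, Matrix.mul_apply, Finset.mul_sum,
    mul_left_comm _ (F _ _)]
  refine ⟨integrable_finsetSum _ fun k _ => integrable_finsetSum _ fun l _ => h k l, ?_⟩
  rw [integral_finsetSum _ fun k _ => integrable_finsetSum _ fun l _ => h k l]
  refine Finset.sum_congr rfl fun k _ => ?_
  rw [integral_finsetSum _ fun l _ => h k l]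
  refine Finset.sum_congr rfl fun l _ => ?_
  rw [integral_const_mul, (integrable_and_ampliate_feed_eq hΛ hs ρ l k).2]

/-- Monotonicity of the RLD Fisher information under `(q, s q) ↦ Λ ∘ (I ⊗ ·)`.  Each point `x`
contributes the test value for the pair `(Λ_x ρ, s(x) Λ_x ρ)`, whose RLD Fisher information is
`s(x)²`. -/
theorem rldTest_feed_le {Λ : ℝ → SuperOp d e} (hΛ : IsHybridChannel Λ) (q : Measure ℝ)
    [IsProbabilityMeasure q] {s : ℝ → ℝ} (hs : Measurable s) {k : ℕ} {ρ : Op (d × Fin k)}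
    (hρ : IsState ρ) (T : Op (e × Fin k)) :
    ENNReal.ofReal (rldTest ((feed Λ q fun _ => 1).ampliate (Fin k) ρ)
      ((feed Λ q s).ampliate (Fin k) ρ) T) ≤ fisherDensity q s := by
  by_cases htop : fisherDensity q s = ⊤
  · simp [htop]
  have hs2 : Integrable (fun x => s x ^ 2) q :=
    ⟨(hs.pow_const 2).aestronglyMeasurable, by
      rw [hasFiniteIntegral_iff_ofReal (Eventually.of_forall fun x => sq_nonneg _)]
      exact lt_top_iff_ne_top.2 htop⟩
  have hs1 : Integrable s q :=
    ((memLp_two_iff_integrable_sq hs.aestronglyMeasurable).2 hs2).integrable one_le_two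
  have h1 := integrable_and_trace_feed_eq hΛ hs1 ρ Tᴴ
  have h2 := integrable_and_trace_feed_eq hΛ (s := fun _ => 1) (integrable_const (μ := q) 1) ρ
    (Tᴴ * T)
  have hcomm (X : Op (e × Fin k)) : (T * X * Tᴴ).trace = (Tᴴ * T * X).trace := by
    rw [Matrix.trace_mul_comm, ← Matrix.mul_assoc]
  rw [fisherDensity, ← ofReal_integral_eq_lintegral_ofReal hs2
    (Eventually.of_forall fun x => sq_nonneg _)]
  refine ENNReal.ofReal_le_ofReal ?_
  have e1 : (∫ x, (s x : ℂ) * (Tᴴ * (Λ x).ampliate (Fin k) ρ).trace ∂q).re =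
      ∫ x, ((s x : ℂ) * (Tᴴ * (Λ x).ampliate (Fin k) ρ).trace).re ∂q :=
    (integral_re (𝕜 := ℂ) h1.1).symm
  have e2 : (∫ x, ((1 : ℝ) : ℂ) * (Tᴴ * T * (Λ x).ampliate (Fin k) ρ).trace ∂q).re =
      ∫ x, (((1 : ℝ) : ℂ) * (Tᴴ * T * (Λ x).ampliate (Fin k) ρ).trace).re ∂q :=
    (integral_re (𝕜 := ℂ) h2.1).symm
  rw [rldTest, hcomm, Matrix.trace_mul_comm, h1.2, h2.2, e1, e2, ← integral_const_mul]
  refine (integral_sub (h1.1.re.const_mul 2) h2.1.re).symm.trans_le ?_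
  refine integral_mono ((h1.1.re.const_mul 2).sub h2.1.re) hs2 fun x => ?_
  have hσ : IsState ((Λ x).ampliate (Fin k) ρ) :=
    hρ.ampliate (hΛ.isChannel x).posSemidef_choi (hΛ.isChannel x).sum_coeff
  have := rldTest_le_of_eq hσ.posSemidef (L := (s x : ℂ) • 1) rfl T
  simp [rldTest, hcomm, hσ.trace_eq_one] at this
  rw [Matrix.trace_mul_comm] at this
  simp
  nlinarith

end simulation

/-! ### Powers of numbers near one -/

section estimates

theorem norm_one_add_pow_sub_le (u : ℂ) (N : ℕ) :
    ‖(1 + u) ^ N - 1 - N * u‖ ≤ (1 + ‖u‖) ^ N - 1 - N * ‖u‖ := by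
  induction N with
  | zero => simp
  | succ N ih =>
    have h1 : (1 + u) ^ (N + 1) - 1 - (N + 1 : ℕ) * u =
        (1 + u) * ((1 + u) ^ N - 1 - N * u) + N * u ^ 2 := by
      push_cast; ring
    have h2 : (1 + ‖u‖) ^ (N + 1) - 1 - (N + 1 : ℕ) * ‖u‖ =
        (1 + ‖u‖) * ((1 + ‖u‖) ^ N - 1 - N * ‖u‖) + N * ‖u‖ ^ 2 := by
      push_cast; ring
    rw [h1, h2]
    refine (norm_add_le _ _).trans (add_le_add ?_ (by simp))
    rw [norm_mul]
    refine mul_le_mul ((norm_add_le _ _).trans (by simp)) ih (norm_nonneg _) (by positivity)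

theorem one_add_pow_le_exp {a : ℝ} (ha : 0 ≤ a) (N : ℕ) : (1 + a) ^ N ≤ Real.exp (N * a) := by
  rw [Real.exp_nat_mul, add_comm]
  exact pow_le_pow_left₀ (by positivity) (Real.add_one_le_exp a) N

theorem norm_one_add_pow_sub_le_sq {u : ℂ} {N : ℕ} (h : N * ‖u‖ ≤ 1) :
    ‖(1 + u) ^ N - 1 - N * u‖ ≤ (N * ‖u‖) ^ 2 := by
  have h0 : (0 : ℝ) ≤ N * ‖u‖ := by positivity
  have h1 := Real.abs_exp_sub_one_sub_id_le (x := N * ‖u‖) (by rwa [abs_of_nonneg h0])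
  have h2 := one_add_pow_le_exp (norm_nonneg u) N
  have h3 := norm_one_add_pow_sub_le u N
  linarith [le_abs_self (Real.exp (N * ‖u‖) - 1 - N * ‖u‖)]

end estimates

/-! ### Product test operators -/

section tests

variable {d e ι : Type*} [Fintype d] [DecidableEq d] [Fintype e] [DecidableEq e]

/-- For `n` copies there are an input state and operators `A i` on the output with ancilla, of
squared norm at most `c`, such that the output `σ` and its derivative `δ` satisfy `tr (A i σ) = 1`,
`tr (A i σ (A j)†) = x i j` and `tr (δ (A i)†) = y i`. -/
def HasTest (Φ Δ : SuperOp d e) (n : ℕ) (x : ι → ι → ℂ) (y : ι → ℂ) (c : ℝ) : Prop :=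
  0 ≤ c ∧ ∃ (k : ℕ) (ρ : Op ((Fin n → d) × Fin k)) (A : ι → Op ((Fin n → e) × Fin k)),
    IsState ρ ∧ (∀ i, (A i * (Φ.power n).ampliate (Fin k) ρ).trace = 1) ∧
    (∀ i j, (A i * (Φ.power n).ampliate (Fin k) ρ * (A j)ᴴ).trace = x i j) ∧
    (∀ i, ((Φ.tangentPower Δ n).ampliate (Fin k) ρ * (A i)ᴴ).trace = y i) ∧
    ∀ i, ((c : ℂ) • 1 - A i * (A i)ᴴ).PosSemidef

variable {Φ Δ : SuperOp d e}

theorem hasTest_trivial [Nonempty d] (hΦ : IsChannel Φ) (hΔ : IsTangent Δ) (n : ℕ) :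
    HasTest Φ Δ n (fun _ _ : ι => 1) (fun _ => 0) 1 := by
  obtain ⟨k, ρ, hρ⟩ := (inferInstance : Nonempty (StateWithAncilla (Fin n → d)))
  refine ⟨zero_le_one, k, ρ, fun _ => 1, hρ, ?_, ?_, ?_, ?_⟩
  · simp [(hΦ.isState_power hρ).trace_eq_one]
  · simp [(hΦ.isState_power hρ).trace_eq_one]
  · simp [hΔ.trace_tangentPower]
  · intro
    simpa using (Matrix.PosSemidef.zero : (0 : Op ((Fin n → e) × Fin k)).PosSemidef)

theorem posSemidef_smul_one_sub_append {m n k l : ℕ} {P : Op ((Fin m → e) × Fin k)}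
    {Q : Op ((Fin n → e) × Fin l)} {a b : ℝ} (hb : 0 ≤ b) (hP : P.PosSemidef)
    (hPa : ((a : ℂ) • 1 - P).PosSemidef) (hQb : ((b : ℂ) • 1 - Q).PosSemidef) :
    (((a * b : ℝ) : ℂ) • 1 - append P Q).PosSemidef := by
  have hb1 : ((b : ℂ) • (1 : Op ((Fin n → e) × Fin l))).PosSemidef :=
    Matrix.PosSemidef.one.smul (by exact_mod_cast hb)
  have h : ((a * b : ℝ) : ℂ) • 1 - append P Q =
      append ((a : ℂ) • 1 - P) ((b : ℂ) • 1) + append P ((b : ℂ) • 1 - Q) := by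
    have h1 : append ((a : ℂ) • (1 : Op ((Fin m → e) × Fin k)))
        ((b : ℂ) • (1 : Op ((Fin n → e) × Fin l))) = ((a * b : ℝ) : ℂ) • 1 := by
      refine Eq.trans ?_ (congrArg _ append_one_one)
      ext
      simp only [append, Matrix.submatrix_apply, Matrix.kroneckerMap_apply, Matrix.smul_apply,
        smul_eq_mul]
      push_cast
      ring
    rw [append_sub_left, append_sub_right, h1]
    abel
  rw [h]
  exact (append_posSemidef hPa hb1).add (append_posSemidef hP hQb)

/-- Since `tr (A i σ) = 1`, joining inputs multiplies the `x i j` and adds the `y i`. -/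
theorem HasTest.append {m n : ℕ} {x x' : ι → ι → ℂ} {y y' : ι → ℂ} {c c' : ℝ} (hΦ : IsChannel Φ)
    (h : HasTest Φ Δ m x y c) (h' : HasTest Φ Δ n x' y' c') :
    HasTest Φ Δ (m + n) (fun i j => x i j * x' i j) (fun i => y i + y' i) (c * c') := by
  obtain ⟨hc, k, ρ, A, hρ, h1, h2, h3, h4⟩ := h
  obtain ⟨hc', k', ρ', A', hρ', h1', h2', h3', h4'⟩ := h'
  have hstar {n k : ℕ} {ρ : Op ((Fin n → d) × Fin k)} {A : Op ((Fin n → e) × Fin k)}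
      (hρ : IsState ρ) (hA : (A * (Φ.power n).ampliate (Fin k) ρ).trace = 1) :
      ((Φ.power n).ampliate (Fin k) ρ * Aᴴ).trace = 1 := by
    have := congrArg star hA
    rwa [← Matrix.trace_conjTranspose, Matrix.conjTranspose_mul,
      (hΦ.isState_power hρ).posSemidef.isHermitian.eq, star_one] at this
  refine ⟨mul_nonneg hc hc', k * k', QChannel.append ρ ρ', fun i => QChannel.append (A i) (A' i),
    hρ.append hρ', fun i => ?_, fun i j => ?_, fun i => ?_, fun i => ?_⟩
  · rw [power_append, append_mul, append_trace, h1, h1', mul_one]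
  · rw [power_append, append_conjTranspose, append_mul, append_mul, append_trace, h2, h2']
  · rw [tangentPower_append, append_conjTranspose, add_mul, append_mul, append_mul,
      Matrix.trace_add, append_trace, append_trace, h3, h3', hstar hρ (h1 i), hstar hρ' (h1' i),
      mul_one, one_mul]
  · rw [append_conjTranspose, append_mul]
    exact posSemidef_smul_one_sub_append hc' (Matrix.posSemidef_self_mul_conjTranspose _)
      (h4 i) (h4' i)

theorem HasTest.pow [Nonempty d] (hΦ : IsChannel Φ) (hΔ : IsTangent Δ) {m : ℕ} {x : ι → ι → ℂ}
    {y : ι → ℂ} {c : ℝ} (h : HasTest Φ Δ m x y c) (N : ℕ) :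
    HasTest Φ Δ (m * N) (fun i j => x i j ^ N) (fun i => N * y i) (c ^ N) := by
  induction N with
  | zero => simpa using hasTest_trivial hΦ hΔ 0
  | succ N ih =>
    have := ih.append hΦ h
    simp only [pow_succ, Nat.cast_succ, add_mul, one_mul, Nat.mul_succ]
    exact this

/-- The copies that are left over after `n / m` full blocks carry the trivial test. -/
theorem HasTest.pow_div [Nonempty d] (hΦ : IsChannel Φ) (hΔ : IsTangent Δ) {m : ℕ}
    {x : ι → ι → ℂ} {y : ι → ℂ} {c : ℝ} (h : HasTest Φ Δ m x y c) (n : ℕ) :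
    HasTest Φ Δ n (fun i j => x i j ^ (n / m)) (fun i => (n / m : ℕ) * y i) (c ^ (n / m)) := by
  have := (h.pow hΦ hΔ (n / m)).append hΦ (hasTest_trivial hΦ hΔ (n % m))
  simpa only [mul_one, add_zero, Nat.div_add_mod] using this

/-- The first-order test operators `1 + i t H` with `H` Hermitian and centred. -/
theorem hasTest_one_add (hΦ : IsChannel Φ) (hΔ : IsTangent Δ) {n k : ℕ}
    {ρ : Op ((Fin n → d) × Fin k)} (hρ : IsState ρ) {H : ι → Op ((Fin n → e) × Fin k)}
    (hH : ∀ i, (H i).IsHermitian) (hc : ∀ i, (H i * (Φ.power n).ampliate (Fin k) ρ).trace = 0)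
    {h : ℝ} (h0 : 0 ≤ h) (hh : ∀ i, ((h : ℂ) • 1 - H i * (H i)ᴴ).PosSemidef) (t : ℝ) :
    HasTest Φ Δ n
      (fun i j => 1 + t ^ 2 * (H i * (Φ.power n).ampliate (Fin k) ρ * (H j)ᴴ).trace)
      (fun i => -(Complex.I * t) * ((Φ.tangentPower Δ n).ampliate (Fin k) ρ * (H i)ᴴ).trace)
      (1 + t ^ 2 * h) := by
  have hσ := hΦ.isState_power hρ
  have hc' (i : ι) : ((Φ.power n).ampliate (Fin k) ρ * (H i)ᴴ).trace = 0 := by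
    have := congrArg star (hc i)
    rwa [← Matrix.trace_conjTranspose, Matrix.conjTranspose_mul, hσ.posSemidef.isHermitian.eq,
      star_zero] at this
  refine ⟨by positivity, k, ρ, fun i => 1 + (Complex.I * t) • H i, hρ, fun i => ?_, fun i j => ?_,
    fun i => ?_, fun i => ?_⟩
  · simp [add_mul, hσ.trace_eq_one, hc]
  · simp [add_mul, mul_add, hσ.trace_eq_one, hc, hc']
    linear_combination (-(t : ℂ) ^ 2 *
      (H i * (Φ.power n).ampliate (Fin k) ρ * (H j)ᴴ).trace) * Complex.I_sq
  · simp [mul_add, hΔ.trace_tangentPower]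
  · have e1 : ((1 + t ^ 2 * h : ℝ) : ℂ) • (1 : Op ((Fin n → e) × Fin k)) -
        (1 + (Complex.I * t) • H i) * (1 + (Complex.I * t) • H i)ᴴ =
        ((t : ℂ) ^ 2) • ((h : ℂ) • 1 - H i * (H i)ᴴ) := by
      simp only [Matrix.conjTranspose_add, Matrix.conjTranspose_one, Matrix.conjTranspose_smul,
        (hH i).eq, add_mul, mul_add, Matrix.smul_mul, Matrix.mul_smul, one_mul, mul_one,
        RCLike.star_def, map_mul, Complex.conj_I, Complex.conj_ofReal, smul_smul]
      have e2 : -Complex.I * (t : ℂ) * (Complex.I * t) = (t : ℂ) ^ 2 := by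
        linear_combination (-(t : ℂ) ^ 2) * Complex.I_sq
      rw [e2]
      push_cast
      module
    rw [e1]
    exact (hh i).smul (by exact_mod_cast sq_nonneg t)

end tests

/-! ### The lower bound from product tests -/

section lowerBound

variable {d e ι : Type*} [Fintype d] [DecidableEq d] [Fintype e] [DecidableEq e] [Fintype ι]

open scoped Matrix.Norms.L2Operator in
/-- Stability of the test value in trace norm. -/
theorem rldTest_sub_le (σ δ σ' δ' T : Op d) {κ a b : ℝ} (hT : ‖T‖ ≤ κ)
    (ha : traceNorm (σ - σ') ≤ a) (hb : traceNorm (δ - δ') ≤ b) :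
    rldTest σ δ T - 2 * κ * b - κ ^ 2 * a ≤ rldTest σ' δ' T := by
  have htr (X : Op d) : 0 ≤ traceNorm X := Finset.sum_nonneg fun _ _ => Real.sqrt_nonneg _
  have hκ := (norm_nonneg T).trans hT
  have h1 : (Tᴴ * (δ - δ')).trace.re ≤ κ * b := by
    refine (Complex.re_le_norm _).trans ((norm_trace_mul_le _ _).trans ?_)
    rw [Matrix.l2_opNorm_conjTranspose]
    exact mul_le_mul hT hb (htr _) hκ
  have h2 : -(Tᴴ * T * (σ - σ')).trace.re ≤ κ ^ 2 * a := by
    refine (neg_le_abs _).trans ((Complex.abs_re_le_norm _).trans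
      ((norm_trace_mul_le _ _).trans ?_))
    rw [Matrix.l2_opNorm_conjTranspose_mul_self, sq]
    exact mul_le_mul (mul_le_mul hT hT (norm_nonneg _) hκ) ha (htr _) (by positivity)
  have hcomm (X : Op d) : (T * X * Tᴴ).trace = (Tᴴ * T * X).trace := by
    rw [Matrix.trace_mul_comm, ← Matrix.mul_assoc]
  simp only [rldTest, hcomm, Matrix.trace_mul_comm _ Tᴴ]
  simp only [Matrix.mul_sub, Matrix.trace_sub, Complex.sub_re] at h1 h2
  linarith

variable {Φ Δ : SuperOp d e}

open scoped Matrix.Norms.L2Operator in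
/-- The lower bound on the Fisher information of a simulation obtained from the test operator
`α ∑ i, w i (A i - 1)`. -/
theorem HasTest.le_fisherDensity (hΦ : IsChannel Φ) (hΔ : IsTangent Δ) {n : ℕ} {x : ι → ι → ℂ}
    {y : ι → ℂ} {c : ℝ} (h : HasTest Φ Δ n x y c) {q : Measure ℝ} [IsProbabilityMeasure q]
    {s : ℝ → ℝ} (hs : Measurable s) {Λ : ℝ → SuperOp (Fin n → d) (Fin n → e)}
    (hΛ : IsHybridChannel Λ) (ha : cbNorm (Φ.power n - feed Λ q fun _ => 1) ≠ ⊤)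
    (hb : cbNorm (Φ.tangentPower Δ n - feed Λ q s) ≠ ⊤) {α κ : ℝ} (hα : 0 ≤ α) (w : ι → ℂ)
    (hκ : α * ∑ i, ‖w i‖ * (√c + 1) ≤ κ) :
    ENNReal.ofReal (2 * α * (∑ i, star (w i) * y i).re -
      α ^ 2 * (∑ i, ∑ j, w i * star (w j) * (x i j - 1)).re -
      2 * κ * (cbNorm (Φ.tangentPower Δ n - feed Λ q s)).toReal -
      κ ^ 2 * (cbNorm (Φ.power n - feed Λ q fun _ => 1)).toReal) ≤ fisherDensity q s := by
  obtain ⟨hc, k, ρ, A, hρ, h1, h2, h3, h4⟩ := h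
  have hσ := hΦ.isState_power hρ
  have hδ := hΔ.trace_tangentPower Φ ρ
  have h1' (i : ι) : ((Φ.power n).ampliate (Fin k) ρ * (A i)ᴴ).trace = 1 := by
    have := congrArg star (h1 i)
    rwa [← Matrix.trace_conjTranspose, Matrix.conjTranspose_mul, hσ.posSemidef.isHermitian.eq,
      star_one] at this
  set T : Op ((Fin n → e) × Fin k) := (α : ℂ) • ∑ i, w i • (A i - 1) with hT
  have hnorm : ‖T‖ ≤ κ := by
    refine le_trans ?_ hκ
    rw [hT, norm_smul, Complex.norm_real, Real.norm_of_nonneg hα]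
    refine mul_le_mul_of_nonneg_left ((norm_sum_le _ _).trans (Finset.sum_le_sum fun i _ => ?_)) hα
    rw [norm_smul]
    refine mul_le_mul_of_nonneg_left ((norm_sub_le _ _).trans (add_le_add
      (norm_le_sqrt_of_posSemidef hc (h4 i)) ?_)) (norm_nonneg _)
    simpa using norm_le_sqrt_of_posSemidef (A := (1 : Op ((Fin n → e) × Fin k))) zero_le_one
      (by simpa using Matrix.PosSemidef.zero)
  have ha' := traceNorm_ampliate_le _ hρ ha
  have hb' := traceNorm_ampliate_le _ hρ hb
  rw [SuperOp.ampliate_sub] at ha' hb'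
  refine le_trans (ENNReal.ofReal_le_ofReal ?_) (rldTest_feed_le hΛ q hs hρ T)
  refine le_trans (le_of_eq ?_) (rldTest_sub_le _ _ _ _ T hnorm ha' hb')
  have e1 : ((Φ.tangentPower Δ n).ampliate (Fin k) ρ * Tᴴ).trace =
      α * ∑ i, star (w i) * y i := by
    simp [hT, Matrix.conjTranspose_sum, Matrix.mul_sum, Matrix.trace_sum, mul_sub, h3, hδ]
  have e2 : (T * (Φ.power n).ampliate (Fin k) ρ * Tᴴ).trace =
      α ^ 2 * ∑ i, ∑ j, w i * star (w j) * (x i j - 1) := by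
    have e3 (i j : ι) : ((A i - 1) * (Φ.power n).ampliate (Fin k) ρ * (A j - 1)ᴴ).trace =
        x i j - 1 := by
      simp [sub_mul, mul_sub, h1, h1', h2, hσ.trace_eq_one]
    simp only [hT, Matrix.conjTranspose_sum, Matrix.conjTranspose_smul, Matrix.sum_mul,
      Matrix.smul_mul, Matrix.mul_smul, Matrix.trace_smul, Matrix.trace_sum, e3,
      smul_eq_mul, Finset.mul_sum, Finset.smul_sum]
    rw [Finset.sum_comm]
    refine Finset.sum_congr rfl fun i _ => Finset.sum_congr rfl fun j _ => ?_
    simp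
    ring
  rw [rldTest, e1, e2, ← Complex.ofReal_pow, Complex.re_ofReal_mul, Complex.re_ofReal_mul]
  ring

/-- Per `N` blocks, the test operators `1 + i t H` with `t = ε / √N` attain the value of `∑ w i H`
up to an error of order `ε²`. -/
theorem re_sum_one_add_pow_le (w : ι → ℂ) (m : ι → ι → ℂ) {ε : ℝ} (hε : 0 < ε)
    (hm : ∀ i j, ε ^ 2 * ‖m i j‖ ≤ 1) {N : ℕ} (hN : 0 < N) :
    (√N / ε) ^ 2 * (∑ i, ∑ j, w i * star (w j) *
      ((1 + ((ε / √N : ℝ) : ℂ) ^ 2 * m i j) ^ N - 1)).re ≤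
    N * ((∑ i, ∑ j, w i * star (w j) * m i j).re +
      ε ^ 2 * ∑ i, ∑ j, ‖w i‖ * ‖w j‖ * ‖m i j‖ ^ 2) := by
  have hN' : (0 : ℝ) < N := by exact_mod_cast hN
  have ht : (N : ℝ) * (ε / √N) ^ 2 = ε ^ 2 := by
    rw [div_pow, Real.sq_sqrt hN'.le]; field_simp
  have ht' : (N : ℂ) * ((ε / √N : ℝ) : ℂ) ^ 2 = (ε : ℂ) ^ 2 := by exact_mod_cast ht
  have key (i j : ι) : (w i * star (w j) * ((1 + ((ε / √N : ℝ) : ℂ) ^ 2 * m i j) ^ N - 1)).re ≤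
      ε ^ 2 * (w i * star (w j) * m i j).re + ε ^ 4 * (‖w i‖ * ‖w j‖ * ‖m i j‖ ^ 2) := by
    set u := ((ε / √N : ℝ) : ℂ) ^ 2 * m i j with hu
    have hNu : (N : ℝ) * ‖u‖ = ε ^ 2 * ‖m i j‖ := by
      rw [hu, norm_mul, norm_pow, Complex.norm_real, Real.norm_eq_abs, sq_abs, ← mul_assoc, ht]
    have hNu' : (N : ℂ) * u = ((ε ^ 2 : ℝ) : ℂ) * m i j := by
      rw [hu, ← mul_assoc, ht']; push_cast; rfl
    have h1 := norm_one_add_pow_sub_le_sq (u := u) (N := N) (by rw [hNu]; exact hm i j)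
    have h2 : (w i * star (w j) * ((1 + u) ^ N - 1)).re =
        ε ^ 2 * (w i * star (w j) * m i j).re +
          (w i * star (w j) * ((1 + u) ^ N - 1 - N * u)).re := by
      rw [hNu', ← Complex.re_ofReal_mul, ← Complex.add_re]
      congr 1
      ring
    rw [h2]
    gcongr
    refine (Complex.re_le_norm _).trans ?_
    rw [norm_mul, norm_mul, norm_star]
    refine (mul_le_mul_of_nonneg_left h1 (by positivity)).trans (le_of_eq ?_)
    rw [hNu]
    ring
  have hsum : (∑ i, ∑ j, w i * star (w j) * ((1 + ((ε / √N : ℝ) : ℂ) ^ 2 * m i j) ^ N - 1)).re ≤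
      ε ^ 2 * ((∑ i, ∑ j, w i * star (w j) * m i j).re +
        ε ^ 2 * ∑ i, ∑ j, ‖w i‖ * ‖w j‖ * ‖m i j‖ ^ 2) := by
    simp only [Complex.re_sum, mul_add, ← mul_assoc, ← pow_add, Finset.mul_sum,
      ← Finset.sum_add_distrib]
    refine Finset.sum_le_sum fun i _ => Finset.sum_le_sum fun j _ => (key i j).trans (le_of_eq ?_)
    ring
  refine (mul_le_mul_of_nonneg_left hsum (by positivity)).trans (le_of_eq ?_)
  rw [div_pow, Real.sq_sqrt hN'.le, ← mul_assoc, div_mul_cancel₀ _ (by positivity)]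

open scoped Matrix.Norms.L2Operator MatrixOrder in
theorem exists_bound_mul_conjTranspose {D : Type*} [Fintype D] [DecidableEq D] (H : ι → Op D) :
    ∃ h : ℝ, 0 ≤ h ∧ ∀ i, ((h : ℂ) • 1 - H i * (H i)ᴴ).PosSemidef := by
  refine ⟨∑ i, ‖H i * (H i)ᴴ‖, by positivity, fun i => ?_⟩
  have h1 : ‖H i * (H i)ᴴ‖ ≤ ∑ i, ‖H i * (H i)ᴴ‖ :=
    Finset.single_le_sum (f := fun i => ‖H i * (H i)ᴴ‖) (fun _ _ => norm_nonneg _)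
      (Finset.mem_univ i)
  have h2 := (CStarAlgebra.norm_le_iff_le_algebraMap _ ((norm_nonneg _).trans h1)
    (Matrix.posSemidef_self_mul_conjTranspose (H i)).nonneg).1 h1
  rwa [Matrix.le_iff, Algebra.algebraMap_eq_smul_one] at h2

theorem IsGaussianShift.isProbabilityMeasure {q : Measure ℝ} {s : ℝ → ℝ} (h : IsGaussianShift q s) :
    IsProbabilityMeasure q := by
  obtain ⟨a, v, c, -, rfl, -⟩ := h
  infer_instance

theorem IsGaussianShift.measurable {q : Measure ℝ} {s : ℝ → ℝ} (h : IsGaussianShift q s) :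
    Measurable s := by
  obtain ⟨a, v, c, -, -, rfl⟩ := h
  fun_prop

end lowerBound

/-! ### Asymptotic simulations -/

section asymptotics

variable {d e : Type*} [Fintype d] [DecidableEq d] [Fintype e] [DecidableEq e]
variable {Φ Δ : SuperOp d e}

/-- The test value of `∑ i, w i • i • H i` in terms of the `H i`. -/
theorem rldTest_sum {D ι : Type*} [Fintype D] [Fintype ι] (σ δ : Op D) (H : ι → Op D) (w : ι → ℂ) :
    rldTest σ δ (∑ i, (w i * Complex.I) • H i) =
      2 * (∑ i, star (w i) * (-Complex.I * (δ * (H i)ᴴ).trace)).re -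
        (∑ i, ∑ j, w i * star (w j) * (H i * σ * (H j)ᴴ).trace).re := by
  rw [rldTest]
  simp only [Matrix.conjTranspose_sum, Matrix.conjTranspose_smul, Matrix.sum_mul,
    Matrix.mul_sum, Matrix.smul_mul, Matrix.mul_smul, Matrix.trace_smul, Matrix.trace_sum,
    smul_eq_mul]
  congr 1
  · refine congrArg (fun z : ℂ => 2 * z.re) (Finset.sum_congr rfl fun i _ => ?_)
    simp
    ring
  · refine congrArg Complex.re ?_
    simp only [Finset.mul_sum]
    rw [Finset.sum_comm]
    refine Finset.sum_congr rfl fun i _ => Finset.sum_congr rfl fun j _ => ?_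
    simp
    linear_combination (-(w i * (starRingEnd ℂ) (w j) * (H i * σ * (H j)ᴴ).trace)) * Complex.I_sq

/-- The test operators of a block of `n` copies bound the rate of a simulation, up to an error of
order `ε²`. -/
theorem rldTest_sub_le_liminf [Nonempty d] {ι : Type*} [Fintype ι] (hΦ : IsChannel Φ)
    (hΔ : IsTangent Δ) {q : ℕ → Measure ℝ} {s : ℕ → ℝ → ℝ}
    {Λ : (n : ℕ) → ℝ → SuperOp (Fin n → d) (Fin n → e)}
    (hq : ∀ n, IsGaussianShift (q n) (s n)) (hsim : IsAsymptoticSimulation Φ Δ q s Λ)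
    {n₀ k : ℕ} (hn₀ : 0 < n₀) {ρ : Op ((Fin n₀ → d) × Fin k)} (hρ : IsState ρ)
    {H : ι → Op ((Fin n₀ → e) × Fin k)} (hH : ∀ i, (H i).IsHermitian)
    (hc : ∀ i, (H i * (Φ.power n₀).ampliate (Fin k) ρ).trace = 0) (w : ι → ℂ)
    {ε : ℝ} (hε : 0 < ε)
    (hm : ∀ i j, ε ^ 2 * ‖(H i * (Φ.power n₀).ampliate (Fin k) ρ * (H j)ᴴ).trace‖ ≤ 1) :
    ENNReal.ofReal ((n₀ : ℝ)⁻¹ * (rldTest ((Φ.power n₀).ampliate (Fin k) ρ)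
      ((Φ.tangentPower Δ n₀).ampliate (Fin k) ρ) (∑ i, (w i * Complex.I) • H i) -
      ε ^ 2 * ∑ i, ∑ j, ‖w i‖ * ‖w j‖ *
        ‖(H i * (Φ.power n₀).ampliate (Fin k) ρ * (H j)ᴴ).trace‖ ^ 2)) ≤
      liminf (fun n => fisherDensity (q n) (s n) / (n : ℝ≥0∞)) atTop := by
  obtain ⟨h, h0, hh⟩ := exists_bound_mul_conjTranspose H
  set σ := (Φ.power n₀).ampliate (Fin k) ρ
  set δ := (Φ.tangentPower Δ n₀).ampliate (Fin k) ρ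
  set V := rldTest σ δ (∑ i, (w i * Complex.I) • H i) -
      ε ^ 2 * ∑ i, ∑ j, ‖w i‖ * ‖w j‖ * ‖(H i * σ * (H j)ᴴ).trace‖ ^ 2 with hV
  set a : ℕ → ℝ≥0∞ := fun n => cbNorm (Φ.power n - feed (Λ n) (q n) fun _ => 1)
  set b : ℕ → ℝ≥0∞ := fun n => cbNorm (Φ.tangentPower Δ n - feed (Λ n) (q n) (s n))
  -- `√N * K` bounds the norm of the test operator for `N` blocks.
  set K := (∑ i, ‖w i‖ * (√(Real.exp (ε ^ 2 * h)) + 1)) / ε with hK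
  have hK0 : 0 ≤ K := by positivity
  have ha := hsim.channel_approx
  have hb := hsim.tangent_approx
  have hlim : Tendsto (fun n : ℕ => ((n / n₀ : ℕ) : ℝ) / n * V -
      2 * K * (b n / ENNReal.ofReal √n).toReal - K ^ 2 * (a n).toReal) atTop
      (𝓝 ((n₀ : ℝ)⁻¹ * V - 2 * K * 0 - K ^ 2 * 0)) := by
    refine (((tendsto_natDiv_div hn₀).mul_const V).sub (Tendsto.const_mul _ ?_)).sub
      (Tendsto.const_mul _ ?_)
    · exact (ENNReal.tendsto_toReal ENNReal.zero_ne_top).comp hb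
    · exact (ENNReal.tendsto_toReal ENNReal.zero_ne_top).comp ha
  simp only [mul_zero, sub_zero] at hlim
  rw [← (ENNReal.tendsto_ofReal hlim).liminf_eq]
  refine liminf_le_liminf ?_
  filter_upwards [ha.eventually_lt_const zero_lt_one, hb.eventually_lt_const zero_lt_one,
    eventually_ge_atTop n₀] with n han hbn hn
  have hn0 : 0 < n := hn₀.trans_le hn
  have hN : 0 < n / n₀ := Nat.div_pos hn hn₀
  have hnR : (0 : ℝ) < n := by exact_mod_cast hn0
  set N := n / n₀ with hNdef
  have hNR : (0 : ℝ) < N := by exact_mod_cast hN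
  have hsN : 0 < √(N : ℝ) := Real.sqrt_pos.2 hNR
  have hNn : (N : ℝ) ≤ n := by exact_mod_cast Nat.div_le_self n n₀
  have han' : a n ≠ ⊤ := (han.trans ENNReal.one_lt_top).ne
  -- `∞ / √n = ∞`, so the completely bounded norms are eventually finite.
  have hbn' : b n ≠ ⊤ := by
    intro hbt
    change b n / _ < 1 at hbn
    rw [hbt, ENNReal.top_div_of_ne_top ENNReal.ofReal_ne_top] at hbn
    exact not_top_lt hbn
  have := (hq n).isProbabilityMeasure
  have htest := (hasTest_one_add hΦ hΔ hρ hH hc h0 hh (ε / √N)).pow_div hΦ hΔ n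
  rw [← hNdef] at htest
  have hcN : (1 + (ε / √N) ^ 2 * h) ^ N ≤ Real.exp (ε ^ 2 * h) := by
    refine (one_add_pow_le_exp (by positivity) N).trans (le_of_eq ?_)
    rw [div_pow, Real.sq_sqrt hNR.le]
    congr 1
    field_simp
  have hJ := htest.le_fisherDensity hΦ hΔ (hq n).measurable (hsim.isHybridChannel n) han' hbn'
    (α := √N / ε) (κ := √N * K) (by positivity) w (by
      rw [hK, div_mul_eq_mul_div, ← mul_div_assoc]
      gcongr)
  rw [ENNReal.le_div_iff_mul_le (Or.inl (by exact_mod_cast hn0.ne'))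
    (Or.inl (ENNReal.natCast_ne_top n)), ← ENNReal.ofReal_natCast,
    ← ENNReal.ofReal_mul' (by positivity)]
  refine le_trans (ENNReal.ofReal_le_ofReal ?_) hJ
  have hy : 2 * (√N / ε) * (∑ i, star (w i) * ((N : ℂ) *
      (-(Complex.I * ((ε / √N : ℝ) : ℂ)) * (δ * (H i)ᴴ).trace))).re =
      N * (2 * (∑ i, star (w i) * (-Complex.I * (δ * (H i)ᴴ).trace)).re) := by
    have e1 : ∑ i, star (w i) * ((N : ℂ) *
        (-(Complex.I * ((ε / √N : ℝ) : ℂ)) * (δ * (H i)ᴴ).trace)) =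
        ((N * (ε / √N) : ℝ) : ℂ) * ∑ i, star (w i) * (-Complex.I * (δ * (H i)ᴴ).trace) := by
      rw [Finset.mul_sum]
      refine Finset.sum_congr rfl fun i _ => ?_
      push_cast
      ring
    rw [e1, Complex.re_ofReal_mul]
    generalize (∑ i, star (w i) * (-Complex.I * (δ * (H i)ᴴ).trace)).re = r
    field_simp
  have hx := re_sum_one_add_pow_le w (fun i j => (H i * σ * (H j)ᴴ).trace) hε hm hN
  have hmain : N * V ≤ 2 * (√N / ε) * (∑ i, star (w i) * ((N : ℂ) *
      (-(Complex.I * ((ε / √N : ℝ) : ℂ)) * (δ * (H i)ᴴ).trace))).re -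
      (√N / ε) ^ 2 * (∑ i, ∑ j, w i * star (w j) *
      ((1 + ((ε / √N : ℝ) : ℂ) ^ 2 * (H i * σ * (H j)ᴴ).trace) ^ N - 1)).re := by
    rw [hy, hV, rldTest_sum]
    linarith
  have hbr : (b n / ENNReal.ofReal √n).toReal = (b n).toReal / √n := by
    rw [ENNReal.toReal_div, ENNReal.toReal_ofReal (Real.sqrt_nonneg _)]
  have herr1 : 2 * (√N * K) * (b n).toReal ≤ 2 * K * ((b n).toReal / √n) * n := by
    have e1 : (b n).toReal / √n * n = √n * (b n).toReal := by
      rw [div_mul_eq_mul_div, mul_comm, mul_div_right_comm, Real.div_sqrt]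
    have e2 : √(N : ℝ) ≤ √n := Real.sqrt_le_sqrt hNn
    rw [mul_assoc (2 * K), e1]
    calc 2 * (√N * K) * (b n).toReal = 2 * K * (√N * (b n).toReal) := by ring
      _ ≤ _ := by gcongr
  have herr2 : (√N * K) ^ 2 * (a n).toReal ≤ K ^ 2 * (a n).toReal * n := by
    rw [mul_pow, Real.sq_sqrt hNR.le]
    calc N * K ^ 2 * (a n).toReal ≤ n * K ^ 2 * (a n).toReal := by gcongr
      _ = _ := by ring
  rw [hbr, sub_mul, sub_mul, div_mul_eq_mul_div, div_mul_cancel₀ _ hnR.ne']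
  linarith

/-- The rate of an asymptotic simulation is at least every test value of a block, per copy. -/
theorem rldTest_le_liminf [Nonempty d] (hΦ : IsChannel Φ)
    (hΔ : IsTangent Δ) {q : ℕ → Measure ℝ} {s : ℕ → ℝ → ℝ}
    {Λ : (n : ℕ) → ℝ → SuperOp (Fin n → d) (Fin n → e)}
    (hq : ∀ n, IsGaussianShift (q n) (s n)) (hsim : IsAsymptoticSimulation Φ Δ q s Λ)
    {n₀ k : ℕ} (hn₀ : 0 < n₀) {ρ : Op ((Fin n₀ → d) × Fin k)} (hρ : IsState ρ)
    {S : Op ((Fin n₀ → e) × Fin k)} (hS : (S * (Φ.power n₀).ampliate (Fin k) ρ).trace = 0) :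
    ENNReal.ofReal ((n₀ : ℝ)⁻¹ * rldTest ((Φ.power n₀).ampliate (Fin k) ρ)
      ((Φ.tangentPower Δ n₀).ampliate (Fin k) ρ) S) ≤
      liminf (fun n => fisherDensity (q n) (s n) / (n : ℝ≥0∞)) atTop := by
  set σ := (Φ.power n₀).ampliate (Fin k) ρ with hσdef
  have hσ : IsState σ := hΦ.isState_power hρ
  have hS' : (Sᴴ * σ).trace = 0 := by
    have := congrArg star hS
    rwa [← Matrix.trace_conjTranspose, Matrix.conjTranspose_mul, hσ.posSemidef.isHermitian.eq,
      Matrix.trace_mul_comm, star_zero] at this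
  -- The Cartesian decomposition of `S`.
  let H : Fin 2 → Op ((Fin n₀ → e) × Fin k) :=
    ![(2⁻¹ : ℂ) • (S + Sᴴ), (-Complex.I * 2⁻¹) • (S - Sᴴ)]
  let w : Fin 2 → ℂ := ![-Complex.I, 1]
  have hH (i : Fin 2) : (H i).IsHermitian := by
    fin_cases i
    · simp [H, Matrix.IsHermitian, Matrix.conjTranspose_smul, add_comm]
    · simp only [H, Matrix.IsHermitian, Fin.mk_one, Matrix.cons_val_one, Matrix.cons_val_fin_one,
        Matrix.conjTranspose_smul, Matrix.conjTranspose_sub, Matrix.conjTranspose_conjTranspose]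
      simp
      rw [← smul_neg, neg_sub]
  have hc (i : Fin 2) : (H i * σ).trace = 0 := by
    fin_cases i
    · simp [H, add_mul, hS, hS']
    · simp [H, sub_mul, hS, hS']
  have hSum : ∑ i, (w i * Complex.I) • H i = S := by
    simp only [Fin.sum_univ_two, H, w, Matrix.cons_val_zero, Matrix.cons_val_one,
      Matrix.cons_val_fin_one, smul_smul]
    have e1 : -Complex.I * Complex.I * 2⁻¹ = 2⁻¹ := by
      linear_combination (-2⁻¹ : ℂ) * Complex.I_sq
    have e2 : 1 * Complex.I * (-Complex.I * 2⁻¹) = 2⁻¹ := by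
      linear_combination (-2⁻¹ : ℂ) * Complex.I_sq
    rw [e1, e2]
    module
  set R := ∑ i, ∑ j, ‖w i‖ * ‖w j‖ * ‖(H i * σ * (H j)ᴴ).trace‖ ^ 2
  set δ := (Φ.tangentPower Δ n₀).ampliate (Fin k) ρ
  have hcont : Tendsto (fun ε : ℝ => ENNReal.ofReal ((n₀ : ℝ)⁻¹ * (rldTest σ δ S - ε ^ 2 * R)))
      (𝓝[>] 0) (𝓝 (ENNReal.ofReal ((n₀ : ℝ)⁻¹ * (rldTest σ δ S - 0 ^ 2 * R)))) :=
    (ENNReal.tendsto_ofReal (Continuous.tendsto (by fun_prop) 0)).mono_left nhdsWithin_le_nhds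
  have h0 : (n₀ : ℝ)⁻¹ * (rldTest σ δ S - 0 ^ 2 * R) = (n₀ : ℝ)⁻¹ * rldTest σ δ S := by ring
  rw [h0] at hcont
  have hsmall : ∀ᶠ ε : ℝ in 𝓝[>] 0, ∀ i j, ε ^ 2 * ‖(H i * σ * (H j)ᴴ).trace‖ ≤ 1 := by
    refine nhdsWithin_le_nhds (eventually_all.2 fun i => eventually_all.2 fun j => ?_)
    have : Tendsto (fun ε : ℝ => ε ^ 2 * ‖(H i * σ * (H j)ᴴ).trace‖) (𝓝 0)
        (𝓝 (0 ^ 2 * ‖(H i * σ * (H j)ᴴ).trace‖)) := Continuous.tendsto (by fun_prop) 0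
    exact (this.eventually_lt_const (by simp)).mono fun _ h => h.le
  refine le_of_tendsto hcont ?_
  filter_upwards [hsmall, self_mem_nhdsWithin] with ε hε hε0
  have := rldTest_sub_le_liminf hΦ hΔ hq hsim hn₀ hρ hH hc w hε0 hε
  rwa [hSum] at this

theorem rateR_le_liminf (hΦ : IsChannel Φ)
    (hΔ : IsTangent Δ) {q : ℕ → Measure ℝ} {s : ℕ → ℝ → ℝ}
    {Λ : (n : ℕ) → ℝ → SuperOp (Fin n → d) (Fin n → e)}
    (hq : ∀ n, IsGaussianShift (q n) (s n)) (hsim : IsAsymptoticSimulation Φ Δ q s Λ)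
    {n : ℕ} (hn : 0 < n) :
    rateR Φ Δ n ≤ liminf (fun n => fisherDensity (q n) (s n) / (n : ℝ≥0∞)) atTop := by
  cases isEmpty_or_nonempty d with
  | inl _ => rw [rateR, GR_eq_zero_of_isEmpty hn, ENNReal.zero_div]; exact zero_le
  | inr _ =>
    have hnR : (0 : ℝ) < n := by exact_mod_cast hn
    rw [rateR, ENNReal.div_le_iff_le_mul (Or.inl (by exact_mod_cast hn.ne'))
      (Or.inl (ENNReal.natCast_ne_top n)), GR_eq_iSup]
    refine iSup_le fun ⟨k, ρ, hρ⟩ => fisherRLD_le_of_rldTest_le fun T => ?_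
    obtain ⟨S, hS, hle⟩ := exists_centred_rldTest_ge (hΦ.isState_power hρ)
      (hΔ.trace_tangentPower Φ ρ) T
    refine (ENNReal.ofReal_le_ofReal hle).trans ?_
    have h := rldTest_le_liminf hΦ hΔ hq hsim hn hρ hS
    rwa [ENNReal.ofReal_mul (by positivity), ENNReal.ofReal_inv_of_pos hnR,
      ENNReal.ofReal_natCast, mul_comm, ← div_eq_mul_inv,
      ENNReal.div_le_iff_le_mul (Or.inl (by exact_mod_cast hn.ne'))
      (Or.inl (ENNReal.natCast_ne_top n))] at h

theorem GpR_le_GpMaxTilde (hΦ : IsChannel Φ) (hΔ : IsTangent Δ) : GpR Φ Δ ≤ GpMaxTilde Φ Δ := by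
  refine le_iInf fun q => le_iInf fun s => le_iInf fun Λ => le_iInf fun hq => le_iInf fun hsim => ?_
  refine limsup_le_of_le (by isBoundedDefault) ?_
  filter_upwards [eventually_gt_atTop 0] with n hn
  exact rateR_le_liminf hΦ hΔ hq hsim hn

end asymptotics
end QChannel

theorem mainTheorem9 {d e : Type*} [Fintype d] [DecidableEq d] [Fintype e] [DecidableEq e]
    (Φ Δ : QChannel.SuperOp d e) (hΦ : QChannel.IsChannel Φ) (hΔ : QChannel.IsTangent Δ) :
    Tendsto (QChannel.rateMin Φ Δ) atTop (𝓝 (QChannel.GpMin Φ Δ)) ∧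
    Tendsto (QChannel.rateR Φ Δ) atTop (𝓝 (QChannel.GpR Φ Δ)) ∧
    QChannel.GpMin Φ Δ ≤ QChannel.GpR Φ Δ ∧
    QChannel.GpR Φ Δ ≤ QChannel.GpMaxTilde Φ Δ :=
  ⟨QChannel.tendsto_rateMin hΦ hΔ, QChannel.tendsto_rateR hΦ hΔ, QChannel.GpMin_le_GpR hΦ,
    QChannel.GpR_le_GpMaxTilde hΦ hΔ⟩
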